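/- **Invariants of $k$-vectors.** Let $\mathbb F$ be a field of characteristic $0$, $V$ a finite-dimensional $\mathbb F$-vector space, $k\ge 1$ and $0\neq X\in\Lambda^kV$. * The length $l(X)$ is the smallest $l\in\mathbb N_0$ such that $X$ is a sum of $l$ decomposable $k$-vectors $v_1\wedge\dots\wedge v_k$. * The support $[X]$ is the intersection of all subspaces $U\subseteq V$ with $X\in\Lambda^kU$; the rank is $\rho(X)=\dim[X]$. * For $0\ne v\in[X]$ and a complement $U$ of $\operatorname{span}(v)$ in $[X]$ write uniquely $X=X_1\wedge v+X_2$ with $X_1\in\Lambda^{k-1}U$, $X_2\in\Lambda^kU$. Then $m(X)$ is the minimum of $l(X_1)$ and $r(X)$ is the minimum of $l(X_2)$ over all choices of $v$ and $U$. **Structures.** Let $V$ be a seven-dimensional real and $W$ a seven-dimensional complex vector space. For a basis $e_1,\dots,e_7$ with dual basis $e^1,\dots,e^7$ write $e^{ijk}=e^i\wedge e^j\wedge e^k$, etc. * A $G_2$-structure on $V$ is a three-form $\varphi\in\Lambda^3V^*$ such that $\varphi=e^{127}+e^{347}+e^{567}+e^{135}-e^{146}-e^{236}-e^{245}$ for some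 basis of $V$. * A $G_2^*$-structure on $V$ is a three-form $\tilde\varphi\in\Lambda^3V^*$ such that $\tilde\varphi=-e^{127}-e^{347}+e^{567}+e^{135}-e^{146}-e^{236}-e^{245}$ for some basis of $V$. * A $(G_2)_{\mathbb C}$-structure on $W$ is a pair $(\varphi_{\mathbb C},\mathrm{vol}_{\mathbb C})\in\Lambda^3W^*\times\Lambda^7W^*$ such that, for some complex basis of $W$, $\varphi_{\mathbb C}=e^{127}+e^{347}+e^{567}+e^{135}-e^{146}-e^{236}-e^{245}$ and $\mathrm{vol}_{\mathbb C}=e^{1234567}$. Bases as above are called adapted. A $G_2$- or $G_2^*$-structure $\varphi$ induces a unique (pseudo-)Euclidean metric $g$ and a unique volume form $\mathrm{vol}$ such that $g(v,w)\,\mathrm{vol}=\tfrac16(v\lrcorner\varphi)\wedge(w\lrcorner\varphi)\wedge\varphi$ for all $v,w$ and every adapted basis is an oriented orthonormal basis. A $(G_2)_{\mathbb C}$-structure induces a unique complex bilinear form $g_{\mathbb C}$ by the same formula, with $\varphi_{\mathbb C}$ and the given $\mathrm{vol}_{\mathbb C}$. In each case the Hodge dual $\star_\varphi\varphi$ is the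 unique four-form with $\varphi\wedge\chi=g(\star_\varphi\varphi,\chi)\,\mathrm{vol}$ for all four-forms $\chi$ (with $g_{\mathbb C},\mathrm{vol}_{\mathbb C}$ in the complex case), where $g$ also denotes the induced bilinear form on four-forms. **Proposition.** Let $\varphi$ be a $G_2$-structure on $V$, let $\tilde\varphi$ be a $G_2^*$-structure on $V$, and let $(\varphi_{\mathbb C},\mathrm{vol}_{\mathbb C})$ be a $(G_2)_{\mathbb C}$-structure on $W$. Then $$(\rho,l,m,r)(\star_\varphi\varphi)=(7,5,3,3),\qquad (\rho,l,m,r)(\star_{\tilde\varphi}\tilde\varphi)=(7,4,2,2),\qquad (\rho,l,m,r)(\star_{\varphi_{\mathbb C}}\varphi_{\mathbb C})=(7,4,2,2).$$ -/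

import Mathlib

namespace G2Inv

open Module

noncomputable section

/-! ### Invariants of `k`-vectors -/

section Invariants

variable {F V : Type*} [Field F] [AddCommGroup V] [Module F V]

/-- A `k`-vector is decomposable if it is of the form `v₁ ∧ ⋯ ∧ v_k`. -/
def IsDecomposable {k : ℕ} (X : ⋀[F]^k V) : Prop :=
  ∃ v : Fin k → V, X = exteriorPower.ιMulti F k v

/-- The (irreducible) length: the least number of decomposable `k`-vectors with sum `X`. -/
def length {k : ℕ} (X : ⋀[F]^k V) : ℕ :=
  sInf {l : ℕ | ∃ Y : Fin l → ⋀[F]^k V, (∀ i, IsDecomposable (Y i)) ∧ X = ∑ i, Y i}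

/-- `Λ^k U`, seen as a subspace of `Λ^k V`, for a subspace `U` of `V`. -/
def subPower (k : ℕ) (U : Submodule F V) : Submodule F (⋀[F]^k V) :=
  LinearMap.range (exteriorPower.map k U.subtype)

/-- The support `[X]`: the intersection of all subspaces `U` of `V` with `X ∈ Λ^k U`. -/
def support {k : ℕ} (X : ⋀[F]^k V) : Submodule F V :=
  sInf {U : Submodule F V | X ∈ subPower k U}

/-- The rank `ρ(X)`: the dimension of the support. -/
def rank {k : ℕ} (X : ⋀[F]^k V) : ℕ := finrank F (support X)

/-- `X = X₁ ∧ v + X₂` with `X₁ ∈ Λ^k U`, `X₂ ∈ Λ^{k+1} U`, where `v` is a non-zero vector of the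
support `[X]` and `U` is a complement of the line spanned by `v` in `[X]`. -/
structure IsSplitting {k : ℕ} (X : ⋀[F]^(k + 1) V) (v : V) (U : Submodule F V)
    (X₁ : ⋀[F]^k V) (X₂ : ⋀[F]^(k + 1) V) : Prop where
  mem_support : v ∈ support X
  ne_zero : v ≠ 0
  inf_eq : Submodule.span F {v} ⊓ U = ⊥
  sup_eq : Submodule.span F {v} ⊔ U = support X
  left_mem : X₁ ∈ subPower k U
  right_mem : X₂ ∈ subPower (k + 1) U
  eq_add : (X : ExteriorAlgebra F V) =
    (X₁ : ExteriorAlgebra F V) * ExteriorAlgebra.ι F v + (X₂ : ExteriorAlgebra F V)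

/-- `D(X)`: the set of all components `X₁` in the splittings `X = X₁ ∧ v + X₂`. -/
def setD {k : ℕ} (X : ⋀[F]^(k + 1) V) : Set (⋀[F]^k V) :=
  {X₁ | ∃ v U X₂, IsSplitting X v U X₁ X₂}

/-- `E(X)`: the set of all components `X₂` in the splittings `X = X₁ ∧ v + X₂`. -/
def setE {k : ℕ} (X : ⋀[F]^(k + 1) V) : Set (⋀[F]^(k + 1) V) :=
  {X₂ | ∃ v U X₁, IsSplitting X v U X₁ X₂}

/-- `m(X)`: the minimal length of an element of `D(X)`. -/
def invM {k : ℕ} (X : ⋀[F]^(k + 1) V) : ℕ := sInf (length '' setD X)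

/-- `r(X)`: the minimal length of an element of `E(X)`. -/
def invR {k : ℕ} (X : ⋀[F]^(k + 1) V) : ℕ := sInf (length '' setE X)

end Invariants

/-! ### Exterior forms and the Hodge star operator -/

section Forms

variable {F V : Type*} [Field F] [AddCommGroup V] [Module F V]

/-- `k`-forms on `V`, i.e. elements of `Λ^k V*`. -/
abbrev Form (F V : Type*) [Field F] [AddCommGroup V] [Module F V] (k : ℕ) : Type _ :=
  ⋀[F]^k (Dual F V)

/-- The contraction `v ⌟ ψ` of a form with a vector. -/
def contract {k : ℕ} (v : V) (ψ : Form F V k) : ExteriorAlgebra F (Dual F V) :=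
  CliffordAlgebra.contractLeft (Dual.eval F V v) (ψ : ExteriorAlgebra F (Dual F V))

/-- `e^{ijk} = e^i ∧ e^j ∧ e^k` for the dual basis of `e`, with indices in `{1,…,7}`. -/
def e3 (e : Basis (Fin 7) F V) (i j k : ℕ) (hi : i - 1 < 7 := by decide)
    (hj : j - 1 < 7 := by decide) (hk : k - 1 < 7 := by decide) : Form F V 3 :=
  exteriorPower.ιMulti F 3 ![e.coord ⟨i - 1, hi⟩, e.coord ⟨j - 1, hj⟩, e.coord ⟨k - 1, hk⟩]

/-- `e^{1234567}` for the dual basis of `e`. -/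
def e7 (e : Basis (Fin 7) F V) : Form F V 7 :=
  exteriorPower.ιMulti F 7 e.coord

/-- `e^{127} + e^{347} + e^{567} + e^{135} - e^{146} - e^{236} - e^{245}`. -/
def g2Form (e : Basis (Fin 7) F V) : Form F V 3 :=
  e3 e 1 2 7 + e3 e 3 4 7 + e3 e 5 6 7 + e3 e 1 3 5 - e3 e 1 4 6 - e3 e 2 3 6 - e3 e 2 4 5

/-- `-e^{127} - e^{347} + e^{567} + e^{135} - e^{146} - e^{236} - e^{245}`. -/
def g2StarForm (e : Basis (Fin 7) F V) : Form F V 3 :=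
  - e3 e 1 2 7 - e3 e 3 4 7 + e3 e 5 6 7 + e3 e 1 3 5 - e3 e 1 4 6 - e3 e 2 3 6 - e3 e 2 4 5

/-- `g(v,w) vol = (1/6) (v ⌟ φ) ∧ (w ⌟ φ) ∧ φ` for all `v, w`. -/
def MetricFormula (φ : Form F V 3) (g : LinearMap.BilinForm F V) (vol : Form F V 7) : Prop :=
  ∀ v w : V, g v w • (vol : ExteriorAlgebra F (Dual F V)) =
    (1 / 6 : F) • (contract v φ * contract w φ * (φ : ExteriorAlgebra F (Dual F V)))

/-- The isomorphism `V* → V` induced by a non-degenerate symmetric bilinear form `g`, inverse to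
`v ↦ g(v, ·)` (and zero if `g` is degenerate). -/
def sharp [FiniteDimensional F V] (g : LinearMap.BilinForm F V) : Dual F V →ₗ[F] V :=
  open Classical in
  if h : g.Nondegenerate then ((g.toDual h).symm : Dual F V →ₗ[F] V) else 0

/-- The bilinear form induced by `g` on `k`-forms:
`g(α₁ ∧ ⋯ ∧ α_k, β₁ ∧ ⋯ ∧ β_k) = det (α_i (♯β_j))`. -/
def formInner [FiniteDimensional F V] (g : LinearMap.BilinForm F V) {k : ℕ}
    (ψ χ : Form F V k) : F :=
  exteriorPower.pairingDual F V k ψ (exteriorPower.map k (sharp g) χ)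

/-- `Ψ` is the Hodge dual of `ψ`: `ψ ∧ χ = g(Ψ, χ) vol` for all `χ` of the same degree as `Ψ`. -/
def IsHodgeDual [FiniteDimensional F V] (g : LinearMap.BilinForm F V) {n k l : ℕ}
    (vol : Form F V n) (ψ : Form F V k) (Ψ : Form F V l) : Prop :=
  ∀ χ : Form F V l, (ψ : ExteriorAlgebra F (Dual F V)) * (χ : ExteriorAlgebra F (Dual F V)) =
    formInner g Ψ χ • (vol : ExteriorAlgebra F (Dual F V))

/-- The Hodge star operator from `k`-forms to `l`-forms, of interest if `k + l = n = dim V`, `g` is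
non-degenerate and `vol ≠ 0`; then there is exactly one Hodge dual. -/
def hodgeStar [FiniteDimensional F V] (g : LinearMap.BilinForm F V) {n k l : ℕ}
    (vol : Form F V n) (ψ : Form F V k) : Form F V l :=
  open Classical in
  if h : ∃ Ψ : Form F V l, IsHodgeDual g vol ψ Ψ then h.choose else 0


theorem contractLeft_mem {M : Type*} [AddCommGroup M] [Module F M] (d : Dual F M) (k : ℕ)
    (x : ExteriorAlgebra F M) (hx : x ∈ ⋀[F]^(k + 1) M) :
    (CliffordAlgebra.contractLeft d x : ExteriorAlgebra F M) ∈ ⋀[F]^k M := by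
  rw [← ExteriorAlgebra.ιMulti_span_fixedDegree] at hx
  induction hx using Submodule.span_induction with
  | zero => simp
  | add x y _ _ hx hy => rw [map_add]; exact add_mem hx hy
  | smul c x _ hx => rw [map_smul]; exact Submodule.smul_mem _ _ hx
  | mem x hx =>
    obtain ⟨v, rfl⟩ := hx
    induction k with
    | zero =>
      rw [ExteriorAlgebra.ιMulti_succ_apply, ExteriorAlgebra.ιMulti_zero_apply]
      erw [CliffordAlgebra.contractLeft_ι_mul, CliffordAlgebra.contractLeft_one]
      simp only [mul_zero, sub_zero]
      refine Submodule.smul_mem _ _ ?_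
      change _ ∈ (LinearMap.range (ExteriorAlgebra.ι F : M →ₗ[F] _)) ^ 0
      rw [pow_zero]
      exact Submodule.one_le.mp le_rfl
    | succ k ih =>
      rw [ExteriorAlgebra.ιMulti_succ_apply]
      erw [CliffordAlgebra.contractLeft_ι_mul]
      refine sub_mem (Submodule.smul_mem _ _ (ExteriorAlgebra.ιMulti_range F _ ⟨_, rfl⟩)) ?_
      change _ ∈ (LinearMap.range (ExteriorAlgebra.ι F : M →ₗ[F] _)) ^ (k + 1)
      rw [pow_succ']
      exact Submodule.mul_mem_mul ⟨_, rfl⟩ (ih _)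

theorem exists_smul_eq [FiniteDimensional F V] {n : ℕ} (hn : finrank F V = n)
    {vol : Form F V n} (hvol : vol ≠ 0) (x : ExteriorAlgebra F (Dual F V))
    (hx : x ∈ ⋀[F]^n (Dual F V)) :
    ∃ c : F, c • (vol : ExteriorAlgebra F (Dual F V)) = x := by
  have h1 : finrank F (Form F V n) = 1 := by
    rw [exteriorPower.finrank_eq, Subspace.dual_finrank_eq, hn, Nat.choose_self]
  obtain ⟨c, hc⟩ := (finrank_eq_one_iff_of_nonzero' vol hvol).1 h1 ⟨x, hx⟩
  exact ⟨c, congrArg Subtype.val hc⟩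

theorem pairingDual_injective [FiniteDimensional F V] (k : ℕ) :
    Function.Injective (exteriorPower.pairingDual F V k) := by
  classical
  let b := finBasis F V
  rw [injective_iff_map_eq_zero]
  intro Ψ h
  have h2 : ∀ s, (b.dualBasis.exteriorPower k).repr Ψ s
      = exteriorPower.pairingDual F V k Ψ (b.exteriorPower k s) := by
    intro s
    have : ((b.dualBasis.exteriorPower k).coord s) =
        (exteriorPower.pairingDual F V k).flip (b.exteriorPower k s) := by
      apply (b.dualBasis.exteriorPower k).ext
      intro t
      rw [Basis.coord_apply, Basis.repr_self]
      have hd : exteriorPower.pairingDual F V k (exteriorPower.ιMulti_family F k b.dualBasis t)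
          = (b.exteriorPower k).coord t := by
        rw [exteriorPower.basis_coord, Basis.coe_dualBasis]
        rfl
      rw [LinearMap.flip_apply, exteriorPower.basis_apply _ _ b.dualBasis, hd, Basis.coord_apply, Basis.repr_self,
        Finsupp.single_apply, Finsupp.single_apply]
      simp [eq_comm]
    exact LinearMap.congr_fun this Ψ
  apply (b.dualBasis.exteriorPower k).repr.injective
  ext s
  rw [h2, h]; simp

/-- The Hodge dual is well defined. -/
theorem existsUnique_isHodgeDual [FiniteDimensional F V] {g : LinearMap.BilinForm F V}
    (hg : g.Nondegenerate) {n k l : ℕ} (hn : finrank F V = n) (hkl : k + l = n)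
    {vol : Form F V n} (hvol : vol ≠ 0) (ψ : Form F V k) :
    ∃! Ψ : Form F V l, IsHodgeDual g vol ψ Ψ := by
  have hv : (vol : ExteriorAlgebra F (Dual F V)) ≠ 0 := by simpa using hvol
  have hs : Function.Surjective (exteriorPower.map l (sharp g)) := by
    apply exteriorPower.map_surjective
    rw [sharp, dif_pos hg]
    exact (g.toDual hg).symm.surjective
  let T : Form F V l →ₗ[F] Dual F (Form F V l) :=
    (exteriorPower.pairingDual F V l).compl₂ (exteriorPower.map l (sharp g))
  have hT : Function.Injective T := by
    rw [injective_iff_map_eq_zero]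
    intro Ψ h
    apply pairingDual_injective l
    refine LinearMap.ext fun y => ?_
    obtain ⟨χ, rfl⟩ := hs y
    rw [map_zero]
    exact LinearMap.congr_fun h χ
  have hT' : Function.Surjective T :=
    (LinearMap.injective_iff_surjective_of_finrank_eq_finrank
      (Subspace.dual_finrank_eq).symm).1 hT
  have hc : ∀ χ : Form F V l, ∃ c : F, c • (vol : ExteriorAlgebra F (Dual F V)) =
      (ψ : ExteriorAlgebra F (Dual F V)) * (χ : ExteriorAlgebra F (Dual F V)) := by
    intro χ
    apply exists_smul_eq hn hvol
    subst hkl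
    change _ ∈ (LinearMap.range (ExteriorAlgebra.ι F : Dual F V →ₗ[F] _)) ^ (k + l)
    rw [pow_add]
    exact Submodule.mul_mem_mul ψ.2 χ.2
  choose c hc using hc
  let L : Dual F (Form F V l) :=
    { toFun := c
      map_add' := fun x y => smul_left_injective F hv (by
        simp only [hc, add_smul, Submodule.coe_add, mul_add])
      map_smul' := fun a x => smul_left_injective F hv (by
        simp [hc, mul_smul]) }
  obtain ⟨Ψ, hΨ⟩ := hT' L
  refine ⟨Ψ, fun χ => ?_, fun Ψ' h' => hT ?_⟩
  · rw [← hc]; exact congrArg (· • _) (LinearMap.congr_fun hΨ χ).symm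
  · rw [hΨ]
    refine LinearMap.ext fun χ => ?_
    exact smul_left_injective F hv ((h' χ).symm.trans (hc χ).symm)

/-- The metric formula determines a unique bilinear form once the volume form is given. -/
theorem existsUnique_metricFormula [FiniteDimensional F V] (hn : finrank F V = 7)
    {vol : Form F V 7} (hvol : vol ≠ 0) (φ : Form F V 3) :
    ∃! g : LinearMap.BilinForm F V, MetricFormula φ g vol := by
  have hv : (vol : ExteriorAlgebra F (Dual F V)) ≠ 0 := by simpa using hvol
  have hc : ∀ v w : V, ∃ c : F, c • (vol : ExteriorAlgebra F (Dual F V)) =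
      (1 / 6 : F) • (contract v φ * contract w φ * (φ : ExteriorAlgebra F (Dual F V))) := by
    intro v w
    apply exists_smul_eq hn hvol
    apply Submodule.smul_mem
    change _ ∈ (LinearMap.range (ExteriorAlgebra.ι F : Dual F V →ₗ[F] _)) ^ (2 + 2 + 3)
    rw [pow_add, pow_add]
    exact Submodule.mul_mem_mul (Submodule.mul_mem_mul (contractLeft_mem _ _ _ φ.2)
      (contractLeft_mem _ _ _ φ.2)) φ.2
  choose c hc using hc
  have ha : ∀ v v' : V, contract (v + v') φ = contract v φ + contract v' φ := by
    intro v v'; simp [contract]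
  have hm : ∀ (a : F) (v : V), contract (a • v) φ = a • contract v φ := by
    intro a v; simp [contract]
  refine ⟨LinearMap.mk₂ F c ?_ ?_ ?_ ?_, fun v w => hc v w, fun g' h' => ?_⟩
  · intro x y z; apply smul_left_injective F hv
    simp only [hc, add_smul, ha, add_mul, smul_add]
  · intro a x z; apply smul_left_injective F hv
    simp only [hc, smul_assoc, hm, smul_mul_assoc, smul_comm a (1/6 : F)]
  · intro x y z; apply smul_left_injective F hv
    simp only [hc, add_smul, ha, add_mul, mul_add, smul_add]
  · intro a x z; apply smul_left_injective F hv
    simp only [hc, smul_assoc, hm, smul_mul_assoc, mul_smul_comm, smul_comm a (1/6 : F)]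
  · ext v w
    exact smul_left_injective F hv ((h' v w).trans (hc v w).symm)

end Forms

/-! ### `G₂`- and `G₂*`-structures on real vector spaces -/

section Real

variable {V : Type*} [AddCommGroup V] [Module ℝ V]

def IsG2Structure (φ : Form ℝ V 3) : Prop :=
  ∃ e : Basis (Fin 7) ℝ V, φ = g2Form e

def IsG2StarStructure (φ : Form ℝ V 3) : Prop :=
  ∃ e : Basis (Fin 7) ℝ V, φ = g2StarForm e

/-- `e` is an adapted basis for the `G₂`- or `G₂*`-structure `φ`. -/
def IsAdapted (φ : Form ℝ V 3) (e : Basis (Fin 7) ℝ V) : Prop :=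
  φ = g2Form e ∨ φ = g2StarForm e

/-- `(g, vol)` are the (pseudo-)Euclidean metric and the metric volume form induced by a `G₂`- or
`G₂*`-structure `φ`: they satisfy `g(v,w) vol = (1/6) (v ⌟ φ) ∧ (w ⌟ φ) ∧ φ`, and each adapted
basis is an oriented orthonormal basis. -/
structure IsInducedMetric (φ : Form ℝ V 3) (g : LinearMap.BilinForm ℝ V) (vol : Form ℝ V 7) :
    Prop where
  formula : MetricFormula φ g vol
  orthogonal : ∀ e, IsAdapted φ e → ∀ i j, i ≠ j → g (e i) (e j) = 0
  normalized : ∀ e, IsAdapted φ e → ∀ i, g (e i) (e i) = 1 ∨ g (e i) (e i) = -1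
  oriented : ∀ e, IsAdapted φ e → vol = e7 e

/-- The metric and the volume form induced by a `G₂`- or `G₂*`-structure. -/
def inducedMetric (φ : Form ℝ V 3) : LinearMap.BilinForm ℝ V × Form ℝ V 7 :=
  open Classical in
  if h : ∃ p : LinearMap.BilinForm ℝ V × Form ℝ V 7, IsInducedMetric φ p.1 p.2
  then h.choose else 0

/-- The Hodge dual `⋆_φ φ` of a `G₂`- or `G₂*`-structure `φ`. -/
def hodgeDual [FiniteDimensional ℝ V] (φ : Form ℝ V 3) : Form ℝ V 4 :=
  hodgeStar (inducedMetric φ).1 (inducedMetric φ).2 φ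

end Real

/-! ### `(G₂)_ℂ`-structures on complex vector spaces -/

section Complex

variable {W : Type*} [AddCommGroup W] [Module ℂ W]

def IsG2CStructure (φ : Form ℂ W 3) (vol : Form ℂ W 7) : Prop :=
  ∃ e : Basis (Fin 7) ℂ W, φ = g2Form e ∧ vol = e7 e

/-- The complex bilinear form induced by a `(G₂)_ℂ`-structure. -/
def inducedMetricC (φ : Form ℂ W 3) (vol : Form ℂ W 7) : LinearMap.BilinForm ℂ W :=
  open Classical in
  if h : ∃ g : LinearMap.BilinForm ℂ W, MetricFormula φ g vol then h.choose else 0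

/-- The Hodge dual `⋆_φ φ` of a `(G₂)_ℂ`-structure `(φ, vol)`. -/
def hodgeDualC [FiniteDimensional ℂ W] (φ : Form ℂ W 3) (vol : Form ℂ W 7) : Form ℂ W 4 :=
  hodgeStar (inducedMetricC φ vol) vol φ

end Complex

end

end G2Inv

/-!
A decomposable `k`-vector `Y` in dimension `n` is annihilated by the `k`-dimensional span of its
factors, so `v ↦ v ∧ Y` has rank at most `n - k`, and the rank of `v ↦ v ∧ X` bounds the length of
`X` from below. The bounds become sharp for `⋆φ` after wedging with a well-chosen vector: some
`v ≠ 0` kills two of the decomposable summands of a four-vector in dimension seven, so a lower bound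
`2 d ≤ rank (w ↦ w ∧ v ∧ X)` for all `v ≠ 0` forces `l ≥ d + 2` and, by similar counting,
`ρ = 7`, `m ≥ d` and `r ≥ d`.

The four-form `⋆φ` encodes the cross product: `u ∧ v ∧ w ∧ ⋆φ` is `g(v × w, u)` times the volume
form. By `v × (v × w) = g(v, w) v - g(v, v) w`, the kernel of `w ↦ w ∧ v ∧ ⋆φ` is the line of `v`
when `g(v, v) ≠ 0`, and it is isotropic, hence of dimension at most three, when `g(v, v) = 0`. This
gives `d = 3` for `G₂`, whose metric is definite, and `d = 2` in the other two cases. The upper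
bounds are explicit decompositions; the cases `d = 2` share a normal form, built from the
eigenvectors of `v × ·` for a non-isotropic `v`.
-/

namespace G2Inv

open Module ExteriorAlgebra

section Wedge

variable {R M : Type*} [CommRing R] [AddCommGroup M] [Module R M]

theorem ι_mul_ι_swap (v w : M) : ι R v * ι R w = -(ι R w * ι R v) :=
  eq_neg_of_add_eq_zero_left (ι_add_mul_swap v w)

theorem ι_mul_ι_mul_swap (v w : M) (x : ExteriorAlgebra R M) :
    ι R v * (ι R w * x) = -(ι R w * (ι R v * x)) := by
  rw [← mul_assoc, ι_mul_ι_swap, neg_mul, mul_assoc]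

theorem ι_mul_ι_mul_self (v : M) (x : ExteriorAlgebra R M) : ι R v * (ι R v * x) = 0 := by
  rw [← mul_assoc, ι_sq_zero, zero_mul]

theorem ι_mul_mul_ι_self (v : M) (x : ExteriorAlgebra R M) : ι R v * (x * ι R v) = 0 := by
  induction x using CliffordAlgebra.left_induction with
  | algebraMap r => exact (congrArg (ι R v * ·) (Algebra.commutes r _)).trans (ι_mul_ι_mul_self v _)
  | add x y hx hy => rw [add_mul, mul_add, hx, hy, add_zero]
  | ι_mul x m hx =>
    change ι R v * (ι R m * x * ι R v) = 0
    rw [mul_assoc, ι_mul_ι_mul_swap, hx, mul_zero, neg_zero]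

theorem ι_mul_ιMulti_cons {k : ℕ} (v : M) (a : Fin k → M) :
    ι R v * ExteriorAlgebra.ιMulti R k a =
      ExteriorAlgebra.ιMulti R (k + 1) (Fin.cons v a : Fin (k + 1) → M) := by
  rw [ExteriorAlgebra.ιMulti_succ_apply]
  rfl

theorem ιMulti_mul_ι_snoc {k : ℕ} (a : Fin k → M) (v : M) :
    ExteriorAlgebra.ιMulti R k a * ι R v =
      ExteriorAlgebra.ιMulti R (k + 1) (Fin.snoc a v : Fin (k + 1) → M) := by
  rw [ExteriorAlgebra.ιMulti_apply, ExteriorAlgebra.ιMulti_apply, List.ofFn_succ']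
  simp

theorem coe_map_exteriorPower {N : Type*} [AddCommGroup N] [Module R N] {k : ℕ} (f : M →ₗ[R] N)
    (X : ⋀[R]^k M) : (exteriorPower.map k f X : ExteriorAlgebra R N) =
      ExteriorAlgebra.map f (X : ExteriorAlgebra R M) := by
  have hX : X ∈ Submodule.span R (Set.range (exteriorPower.ιMulti R k (M := M))) := by
    rw [exteriorPower.ιMulti_span]; trivial
  induction hX using Submodule.span_induction with
  | zero => simp
  | add X Y _ _ hX hY => simp only [map_add, Submodule.coe_add, hX, hY]
  | smul c X _ hX => simp only [map_smul, Submodule.coe_smul, hX]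
  | mem X hX =>
    obtain ⟨a, rfl⟩ := hX
    rw [exteriorPower.map_apply_ιMulti, exteriorPower.ιMulti_apply_coe,
      exteriorPower.ιMulti_apply_coe, ExteriorAlgebra.map_apply_ιMulti]

/-- The linear map `v ↦ v ∧ x`. Its rank controls how many decomposable vectors are needed to
write `x` as a sum. -/
def wedge (x : ExteriorAlgebra R M) : M →ₗ[R] ExteriorAlgebra R M :=
  LinearMap.mulRight R x ∘ₗ ι R

@[simp]
theorem wedge_apply (x : ExteriorAlgebra R M) (v : M) : wedge x v = ι R v * x := rfl

theorem wedge_add (x y : ExteriorAlgebra R M) : wedge (x + y) = wedge x + wedge y :=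
  LinearMap.ext fun v => mul_add (ι R v) x y

end Wedge

section WedgeRank

variable {F E : Type*} [Field F] [AddCommGroup E] [Module F E]

/-- The rank of `v ↦ v ∧ x`, that is, the codimension of the annihilator of `x` in `E`. -/
noncomputable def wedgeRank (x : ExteriorAlgebra F E) : ℕ := finrank F (wedge x).range

@[simp]
theorem wedgeRank_zero : wedgeRank (0 : ExteriorAlgebra F E) = 0 := by
  have : wedge (0 : ExteriorAlgebra F E) = 0 := LinearMap.ext fun v => mul_zero (ι F v)
  rw [wedgeRank, this, LinearMap.range_zero, finrank_bot]

variable [FiniteDimensional F E]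

theorem wedgeRank_add_le (x y : ExteriorAlgebra F E) :
    wedgeRank (x + y) ≤ wedgeRank x + wedgeRank y := by
  rw [wedgeRank, wedge_add]
  exact (Submodule.finrank_mono (LinearMap.range_add_le _ _)).trans
    (Submodule.finrank_add_le_finrank_add_finrank _ _)

theorem wedgeRank_sum_le {α : Type*} (s : Finset α) (x : α → ExteriorAlgebra F E) :
    wedgeRank (∑ i ∈ s, x i) ≤ ∑ i ∈ s, wedgeRank (x i) :=
  Finset.le_sum_of_subadditive _ wedgeRank_zero.le wedgeRank_add_le s x

theorem wedgeRank_le_sub_iff {x : ExteriorAlgebra F E} {k : ℕ} (hk : k ≤ finrank F E) :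
    wedgeRank x ≤ finrank F E - k ↔ k ≤ finrank F (wedge x).ker := by
  have := (wedge x).finrank_range_add_finrank_ker
  rw [wedgeRank]
  omega

theorem wedgeRank_le_sub {x : ExteriorAlgebra F E} {P : Submodule F E}
    (hP : ∀ v ∈ P, ι F v * x = 0) : wedgeRank x ≤ finrank F E - finrank F P :=
  (wedgeRank_le_sub_iff P.finrank_le).2 (Submodule.finrank_mono hP)

theorem wedgeRank_ιMulti_le {k : ℕ} (a : Fin k → E) :
    wedgeRank (ExteriorAlgebra.ιMulti F k a) ≤ finrank F E - k := by
  by_cases ha : LinearIndependent F a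
  · have hspan : finrank F (Submodule.span F (Set.range a)) = k := by
      rw [finrank_span_eq_card ha, Fintype.card_fin]
    have hker : Submodule.span F (Set.range a) ≤ (wedge (ExteriorAlgebra.ιMulti F k a)).ker := by
      rw [Submodule.span_le]
      rintro _ ⟨i, rfl⟩
      rw [SetLike.mem_coe, LinearMap.mem_ker, wedge_apply, ι_mul_ιMulti_cons]
      exact AlternatingMap.map_eq_zero_of_eq _ _ (i := 0) (j := i.succ) (by simp)
        (Fin.succ_ne_zero i).symm
    simpa only [hspan] using wedgeRank_le_sub hker
  · rw [AlternatingMap.map_linearDependent _ _ ha, wedgeRank_zero]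
    exact Nat.zero_le _

theorem wedgeRank_le_of_mem_subPower {k : ℕ} {U : Submodule F E} (hU : finrank F U = k + 1)
    {X : ⋀[F]^k E} (hX : X ∈ subPower k U) :
    wedgeRank (X : ExteriorAlgebra F E) ≤ finrank F E - k := by
  obtain ⟨X', rfl⟩ := hX
  let f := wedge (exteriorPower.map k U.subtype X' : ExteriorAlgebra F E)
  have hrange : (f.domRestrict U).range ≤
      (⋀[F]^(k + 1) U).map (ExteriorAlgebra.map U.subtype).toLinearMap := by
    rintro _ ⟨u, rfl⟩
    refine ⟨ι F u * (X' : ExteriorAlgebra F U), ?_, ?_⟩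
    · rw [exteriorPower, pow_succ']
      exact Submodule.mul_mem_mul ⟨u, rfl⟩ X'.2
    · simp [f, coe_map_exteriorPower]
  have hline : finrank F (f.domRestrict U).range ≤ 1 := by
    refine (Submodule.finrank_mono hrange).trans ((Submodule.finrank_map_le _ _).trans ?_)
    rw [exteriorPower.finrank_eq, hU, Nat.choose_self]
  have hker : finrank F (f.domRestrict U).ker ≤ finrank F f.ker := by
    rw [← Submodule.finrank_map_subtype_eq]
    refine Submodule.finrank_mono ?_
    rintro _ ⟨u, hu, rfl⟩
    exact hu
  have := (f.domRestrict U).finrank_range_add_finrank_ker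
  have := U.finrank_le
  exact (wedgeRank_le_sub_iff (by omega)).2 (show k ≤ finrank F f.ker by omega)

theorem exists_common_factor {α : Type*} [Fintype α] (x : α → ExteriorAlgebra F E)
    {U : Submodule F E} (h : ∑ i, wedgeRank (x i) < finrank F U) :
    ∃ v ∈ U, v ≠ 0 ∧ ∀ i, ι F v * x i = 0 := by
  let f : U →ₗ[F] ∀ i, (wedge (x i)).range :=
    LinearMap.pi fun i => (wedge (x i)).rangeRestrict.domRestrict U
  have hker : f.ker ≠ ⊥ := LinearMap.ker_ne_bot_of_finrank_lt (by rwa [finrank_pi_fintype])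
  obtain ⟨u, hu, hu0⟩ := Submodule.exists_mem_ne_zero_of_ne_bot hker
  exact ⟨u, u.2, by simpa using hu0, fun i => congrArg Subtype.val (congrFun hu i)⟩

end WedgeRank

section Length

variable {F E : Type*} [Field F] [AddCommGroup E] [Module F E] {k : ℕ}

theorem IsDecomposable.exists_ι_mul_eq {X : ⋀[F]^k E} (hX : IsDecomposable X) (v : E) :
    ∃ Y : ⋀[F]^(k + 1) E, IsDecomposable Y ∧ (Y : ExteriorAlgebra F E) = ι F v * X := by
  obtain ⟨a, rfl⟩ := hX
  exact ⟨_, ⟨_, rfl⟩, (ι_mul_ιMulti_cons v a).symm⟩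

theorem IsDecomposable.exists_mul_ι_eq {X : ⋀[F]^k E} (hX : IsDecomposable X) (v : E) :
    ∃ Y : ⋀[F]^(k + 1) E, IsDecomposable Y ∧ (Y : ExteriorAlgebra F E) = X * ι F v := by
  obtain ⟨a, rfl⟩ := hX
  exact ⟨_, ⟨_, rfl⟩, (ιMulti_mul_ι_snoc a v).symm⟩

theorem IsDecomposable.wedgeRank_le [FiniteDimensional F E] {X : ⋀[F]^k E}
    (hX : IsDecomposable X) : wedgeRank (X : ExteriorAlgebra F E) ≤ finrank F E - k := by
  obtain ⟨a, rfl⟩ := hX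
  exact wedgeRank_ιMulti_le a

theorem length_sum_le {α : Type*} (s : Finset α) {Y : α → ⋀[F]^k E}
    (hY : ∀ i ∈ s, IsDecomposable (Y i)) : length (∑ i ∈ s, Y i) ≤ s.card :=
  Nat.sInf_le ⟨fun i => Y (s.equivFin.symm i), fun i => hY _ (s.equivFin.symm i).2, by
    rw [s.equivFin.symm.sum_comp fun i => Y i, Finset.sum_coe_sort]⟩

section NeZero

variable [NeZero k]

theorem IsDecomposable.smul {X : ⋀[F]^k E} (hX : IsDecomposable X) (c : F) :
    IsDecomposable (c • X) := by
  obtain ⟨a, rfl⟩ := hX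
  exact ⟨Function.update a 0 (c • a 0), by
    rw [AlternatingMap.map_update_smul, Function.update_eq_self]⟩

theorem exists_sum_isDecomposable (X : ⋀[F]^k E) :
    ∃ (l : ℕ) (Y : Fin l → ⋀[F]^k E), (∀ i, IsDecomposable (Y i)) ∧ X = ∑ i, Y i := by
  have hX : X ∈ Submodule.span F (Set.range (exteriorPower.ιMulti F k (M := E))) := by
    rw [exteriorPower.ιMulti_span]; trivial
  obtain ⟨l, c, Y, rfl⟩ := Submodule.mem_span_set'.1 hX
  exact ⟨l, fun i => c i • (Y i : ⋀[F]^k E),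
    fun i => IsDecomposable.smul (by obtain ⟨a, ha⟩ := (Y i).2; exact ⟨a, ha.symm⟩) _, rfl⟩

theorem exists_sum_eq_of_length (X : ⋀[F]^k E) :
    ∃ Y : Fin (length X) → ⋀[F]^k E, (∀ i, IsDecomposable (Y i)) ∧
      (X : ExteriorAlgebra F E) = ∑ i, (Y i : ExteriorAlgebra F E) := by
  obtain ⟨Y, hY, hX⟩ := Nat.sInf_mem (exists_sum_isDecomposable X)
  exact ⟨Y, hY, (congrArg Subtype.val hX).trans (Submodule.coe_sum _ _ _)⟩

theorem wedgeRank_le_length_mul [FiniteDimensional F E] (X : ⋀[F]^k E) :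
    wedgeRank (X : ExteriorAlgebra F E) ≤ length X * (finrank F E - k) := by
  obtain ⟨Y, hY, hX⟩ := exists_sum_eq_of_length X
  calc wedgeRank (X : ExteriorAlgebra F E)
      = wedgeRank (∑ i, (Y i : ExteriorAlgebra F E)) := by rw [← hX]
    _ ≤ ∑ i, wedgeRank (Y i : ExteriorAlgebra F E) := wedgeRank_sum_le _ _
    _ ≤ ∑ _ : Fin (length X), (finrank F E - k) :=
        Finset.sum_le_sum fun i _ => (hY i).wedgeRank_le
    _ = length X * (finrank F E - k) := by simp

theorem exists_mul_ι_eq (X : ⋀[F]^k E) (v : E) :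
    ∃ Z : ⋀[F]^(k + 1) E, (Z : ExteriorAlgebra F E) = X * ι F v ∧ length Z ≤ length X := by
  obtain ⟨Y, hY, hX⟩ := exists_sum_eq_of_length X
  choose Z hZ hZY using fun i => (hY i).exists_mul_ι_eq v
  refine ⟨∑ i, Z i, ?_, (length_sum_le _ fun i _ => hZ i).trans (by simp)⟩
  simp only [hX, Submodule.coe_sum, Finset.sum_mul, hZY]

theorem exists_ι_mul_eq (X : ⋀[F]^k E) (v : E) :
    ∃ Z : ⋀[F]^(k + 1) E, (Z : ExteriorAlgebra F E) = ι F v * X ∧ length Z ≤ length X := by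
  obtain ⟨Y, hY, hX⟩ := exists_sum_eq_of_length X
  choose Z hZ hZY using fun i => (hY i).exists_ι_mul_eq v
  refine ⟨∑ i, Z i, ?_, (length_sum_le _ fun i _ => hZ i).trans (by simp)⟩
  simp only [hX, Submodule.coe_sum, Finset.mul_sum, hZY]

theorem exists_ι_mul_eq_of_length_sub [FiniteDimensional F E] (X : ⋀[F]^k E)
    {U : Submodule F E} {j : ℕ} (hj : j * (finrank F E - k) < finrank F U) :
    ∃ v ∈ U, v ≠ 0 ∧ ∃ Z : ⋀[F]^(k + 1) E,
      (Z : ExteriorAlgebra F E) = ι F v * X ∧ length Z ≤ length X - j := by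
  obtain ⟨Y, hY, hX⟩ := exists_sum_eq_of_length X
  let killed : Finset (Fin (length X)) := {i | (i : ℕ) < j}
  have hcard : killed.card = min (length X) j := Fin.card_filter_val_lt
  have hrank : ∑ i : killed, wedgeRank (Y i : ExteriorAlgebra F E) < finrank F U := by
    refine lt_of_le_of_lt ((Finset.sum_le_sum fun i _ => (hY i.1).wedgeRank_le).trans ?_) hj
    simpa [hcard] using Nat.mul_le_mul_right _ (min_le_right (length X) j)
  obtain ⟨v, hvU, hv, hvY⟩ := exists_common_factor _ hrank
  choose Z hZ hZY using fun i => (hY i).exists_ι_mul_eq v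
  refine ⟨v, hvU, hv, ∑ i ∈ killedᶜ, Z i, ?_, (length_sum_le _ fun i _ => hZ i).trans ?_⟩
  · rw [hX, Submodule.coe_sum, Finset.mul_sum, ← killed.sum_add_sum_compl,
      Finset.sum_eq_zero fun i hi => hvY ⟨i, hi⟩, zero_add]
    exact Finset.sum_congr rfl fun i _ => hZY i
  · rw [Finset.card_compl, Fintype.card_fin, hcard]
    omega

end NeZero

theorem sInf_image_length_eq {n : ℕ} {S : Set (⋀[F]^k E)} (hS : ∀ X ∈ S, n ≤ length X)
    {X : ⋀[F]^k E} (hX : X ∈ S) (hn : length X ≤ n) : sInf (length '' S) = n := by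
  have hXS := Set.mem_image_of_mem length hX
  refine le_antisymm ((Nat.sInf_le hXS).trans hn) (le_csInf ⟨_, hXS⟩ ?_)
  rintro _ ⟨Y, hY, rfl⟩
  exact hS Y hY

end Length

section Splitting

variable {F E : Type*} [Field F] [AddCommGroup E] [Module F E] {k : ℕ}

theorem subPower_mono {U U' : Submodule F E} (h : U ≤ U') :
    subPower (F := F) k U ≤ subPower k U' := by
  rintro _ ⟨X, rfl⟩
  refine ⟨exteriorPower.map k (Submodule.inclusion h) X, ?_⟩
  rw [← LinearMap.comp_apply, ← exteriorPower.map_comp]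
  rfl

theorem ιMulti_mem_subPower {U : Submodule F E} {a : Fin k → E} (ha : ∀ i, a i ∈ U) :
    exteriorPower.ιMulti F k a ∈ subPower k U :=
  ⟨exteriorPower.ιMulti F k fun i => (⟨a i, ha i⟩ : U), by
    rw [exteriorPower.map_apply_ιMulti]; rfl⟩

theorem exists_ι_mul_mem_subPower {U : Submodule F E} {v : E} (hv : v ∈ U) {X : ⋀[F]^k E}
    (hX : X ∈ subPower k U) :
    ∃ Z ∈ subPower (k + 1) U, (Z : ExteriorAlgebra F E) = ι F v * X := by
  obtain ⟨X', rfl⟩ := hX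
  have hmem : ι F (⟨v, hv⟩ : U) * (X' : ExteriorAlgebra F U) ∈ ⋀[F]^(k + 1) U := by
    rw [exteriorPower, pow_succ']
    exact Submodule.mul_mem_mul ⟨_, rfl⟩ X'.2
  exact ⟨_, ⟨⟨_, hmem⟩, rfl⟩, by simp [coe_map_exteriorPower]⟩

theorem isSplitting_ker {X : ⋀[F]^(k + 1) E} (hX : support X = ⊤) {v : E} {ξ : Dual F E}
    (hξ : ξ v ≠ 0) {X₁ : ⋀[F]^k E} {X₂ : ⋀[F]^(k + 1) E}
    (h₁ : X₁ ∈ subPower k (LinearMap.ker ξ)) (h₂ : X₂ ∈ subPower (k + 1) (LinearMap.ker ξ))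
    (h : (X : ExteriorAlgebra F E) = X₁ * ι F v + X₂) :
    IsSplitting X v (LinearMap.ker ξ) X₁ X₂ where
  mem_support := hX ▸ Submodule.mem_top
  ne_zero := by rintro rfl; exact hξ (map_zero ξ)
  inf_eq := by
    rw [Submodule.eq_bot_iff]
    rintro x ⟨hx, hx'⟩
    obtain ⟨c, rfl⟩ := Submodule.mem_span_singleton.1 hx
    have : c = 0 := by simpa [hξ] using hx'
    rw [this, zero_smul]
  sup_eq := by
    rw [hX, eq_top_iff]
    intro x _
    rw [← add_sub_cancel ((ξ x / ξ v) • v) x]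
    refine Submodule.add_mem_sup (Submodule.smul_mem _ _ (Submodule.mem_span_singleton_self v)) ?_
    simp [hξ]
  left_mem := h₁
  right_mem := h₂
  eq_add := h

namespace IsSplitting

variable {X : ⋀[F]^(k + 1) E} {v : E} {U : Submodule F E} {X₁ : ⋀[F]^k E} {X₂ : ⋀[F]^(k + 1) E}

theorem ι_mul (hs : IsSplitting X v U X₁ X₂) :
    ι F v * (X : ExteriorAlgebra F E) = ι F v * X₂ := by
  rw [hs.eq_add, mul_add, ι_mul_mul_ι_self, zero_add]

theorem finrank_add_one (hs : IsSplitting X v U X₁ X₂) [FiniteDimensional F E] :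
    finrank F U + 1 = rank X := by
  have := Submodule.finrank_sup_add_finrank_inf_eq (Submodule.span F {v}) U
  rw [hs.inf_eq, hs.sup_eq, finrank_bot, finrank_span_singleton hs.ne_zero] at this
  rw [rank]
  omega

end IsSplitting

end Splitting

section LowerBounds

variable {F E : Type*} [Field F] [AddCommGroup E] [Module F E] [FiniteDimensional F E] {k d : ℕ}

theorem wedgeRank_ι_mul_le_of_mem_subPower {U : Submodule F E} (hU : finrank F U = k + 2)
    {v : E} (hv : v ∈ U) {X : ⋀[F]^k E} (hX : X ∈ subPower k U) :
    wedgeRank (ι F v * (X : ExteriorAlgebra F E)) ≤ finrank F E - (k + 1) := by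
  obtain ⟨Z, hZ, hZX⟩ := exists_ι_mul_mem_subPower hv hX
  exact hZX ▸ wedgeRank_le_of_mem_subPower hU hZ

theorem wedgeRank_ι_mul_le_length_mul [NeZero k] (X : ⋀[F]^k E) (v : E) :
    wedgeRank (ι F v * (X : ExteriorAlgebra F E)) ≤ length X * (finrank F E - (k + 1)) := by
  obtain ⟨Z, hZ, hlength⟩ := exists_ι_mul_eq X v
  exact hZ ▸ (wedgeRank_le_length_mul Z).trans (Nat.mul_le_mul_right _ hlength)

theorem support_eq_top_of_lt_wedgeRank (hE : finrank F E = k + 3) {X : ⋀[F]^k E}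
    (h : ∀ v ≠ 0, 2 < wedgeRank (ι F v * (X : ExteriorAlgebra F E))) : support X = ⊤ := by
  refine sInf_eq_top.2 fun U hU => ?_
  by_contra hne
  obtain ⟨ξ, hξ, hle⟩ := Submodule.exists_le_ker_of_lt_top U (lt_top_iff_ne_top.2 hne)
  have hker : finrank F (LinearMap.ker ξ) = k + 2 := by
    have := Module.Dual.finrank_ker_add_one_of_ne_zero hξ
    omega
  have hpos : 0 < finrank F (LinearMap.ker ξ) := by omega
  obtain ⟨p, hp⟩ := finrank_pos_iff_exists_ne_zero.1 hpos
  have := wedgeRank_ι_mul_le_of_mem_subPower hker p.2 (subPower_mono hle hU)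
  have := h p (by simpa using hp)
  omega

theorem add_two_le_length (hk : 4 ≤ k) (hE : finrank F E = k + 3) (hd : 0 < d) {X : ⋀[F]^k E}
    (h : ∀ v ≠ 0, 2 * d ≤ wedgeRank (ι F v * (X : ExteriorAlgebra F E))) :
    d + 2 ≤ length X := by
  have : NeZero k := ⟨by omega⟩
  obtain ⟨v, -, hv, Z, hZ, hlength⟩ :=
    exists_ι_mul_eq_of_length_sub X (U := ⊤) (j := 2) (by rw [finrank_top]; omega)
  have hrank := hZ ▸ wedgeRank_le_length_mul Z
  rw [hE, show k + 3 - (k + 1) = 2 by omega] at hrank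
  have := h v hv
  omega

theorem IsSplitting.le_length_right (hE : finrank F E = k + 4) {X : ⋀[F]^(k + 1) E}
    (h : ∀ v ≠ 0, 2 * d ≤ wedgeRank (ι F v * (X : ExteriorAlgebra F E))) {v U X₁ X₂}
    (hs : IsSplitting X v U X₁ X₂) : d ≤ length X₂ := by
  have hrank := hs.ι_mul ▸ wedgeRank_ι_mul_le_length_mul X₂ v
  rw [hE, show k + 4 - (k + 1 + 1) = 2 by omega] at hrank
  have := h v hs.ne_zero
  omega

theorem IsSplitting.le_length_left (hk : 2 ≤ k) (hE : finrank F E = k + 4) (hd : 2 ≤ d)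
    {X : ⋀[F]^(k + 1) E} (h : ∀ v ≠ 0, 2 * d ≤ wedgeRank (ι F v * (X : ExteriorAlgebra F E)))
    {v U X₁ X₂} (hs : IsSplitting X v U X₁ X₂) : d ≤ length X₁ := by
  have : NeZero k := ⟨by omega⟩
  have hU : finrank F U = k + 3 := by
    have := hs.finrank_add_one
    rw [rank, support_eq_top_of_lt_wedgeRank hE fun v hv => lt_of_lt_of_le (by omega) (h v hv),
      finrank_top] at this
    omega
  obtain ⟨p, hpU, hp, Z, hZ, hlengthZ⟩ :=
    exists_ι_mul_eq_of_length_sub X₁ (U := U) (j := 1) (by omega)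
  obtain ⟨Z', hZ', hlengthZ'⟩ := exists_mul_ι_eq Z v
  have hsplit : ι F p * (X : ExteriorAlgebra F E) = Z' + ι F p * X₂ := by
    rw [hs.eq_add, mul_add, ← mul_assoc, ← hZ, hZ']
  have hrank := hsplit ▸ wedgeRank_add_le _ _
  have hleft := wedgeRank_le_length_mul Z'
  have hright := wedgeRank_ι_mul_le_of_mem_subPower hU hpU hs.right_mem
  rw [hE, show k + 4 - (k + 1 + 1) = 2 by omega] at hleft hright
  have := h p hp
  omega

theorem invariants_eq_of_le_wedgeRank (hk : 3 ≤ k) (hE : finrank F E = k + 4) (hd : 2 ≤ d)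
    {X : ⋀[F]^(k + 1) E} (h : ∀ v ≠ 0, 2 * d ≤ wedgeRank (ι F v * (X : ExteriorAlgebra F E)))
    (hX : length X ≤ d + 2) (hleft : support X = ⊤ → ∃ X₁ ∈ setD X, length X₁ ≤ d)
    (hright : support X = ⊤ → ∃ X₂ ∈ setE X, length X₂ ≤ d) :
    (rank X, length X, invM X, invR X) = (k + 4, d + 2, d, d) := by
  have htop : support X = ⊤ :=
    support_eq_top_of_lt_wedgeRank hE fun v hv => lt_of_lt_of_le (by omega) (h v hv)
  obtain ⟨X₁, hX₁, hlength₁⟩ := hleft htop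
  obtain ⟨X₂, hX₂, hlength₂⟩ := hright htop
  have hrank : rank X = k + 4 := by rw [rank, htop, finrank_top, hE]
  have hlength : length X = d + 2 := hX.antisymm (add_two_le_length (by omega) hE (by omega) h)
  have hM : invM X = d := sInf_image_length_eq
    (fun _ ⟨_, _, _, hs⟩ => hs.le_length_left (by omega) hE hd h) hX₁ hlength₁
  have hR : invR X = d := sInf_image_length_eq
    (fun _ ⟨_, _, _, hs⟩ => hs.le_length_right hE h) hX₂ hlength₂
  rw [hrank, hlength, hM, hR]

end LowerBounds

section DiagonalMetric

variable {F E α : Type*} [Field F] [AddCommGroup E] [Module F E] [Fintype α] [DecidableEq α]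

/-- The symmetric bilinear form with Gram matrix `diag(ε)` in the basis `b`. -/
noncomputable def diagMetric (ε : α → F) (b : Basis α F E) : LinearMap.BilinForm F E :=
  Matrix.toBilin b (Matrix.diagonal ε)

theorem diagMetric_apply (ε : α → F) (b : Basis α F E) (v w : E) :
    diagMetric ε b v w = ∑ i, ε i * b.repr v i * b.repr w i := by
  rw [diagMetric, Matrix.toBilin_apply]
  refine Finset.sum_congr rfl fun i _ => ?_
  rw [Finset.sum_eq_single i (fun j _ hj => by simp [Matrix.diagonal_apply_ne _ hj.symm]) (by simp),
    Matrix.diagonal_apply_eq, mul_comm (b.repr v i)]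

theorem diagMetric_basis (ε : α → F) (b : Basis α F E) (i j : α) :
    diagMetric ε b (b i) (b j) = if i = j then ε i else 0 := by
  rw [diagMetric_apply, Finset.sum_eq_single i (fun k _ hk => by simp [hk.symm]) (by simp)]
  simp [Finsupp.single_apply, eq_comm]

theorem diagMetric_isSymm (ε : α → F) (b : Basis α F E) : (diagMetric ε b).IsSymm where
  eq v w := by
    simp only [diagMetric_apply]
    exact Finset.sum_congr rfl fun i _ => mul_right_comm _ _ _

theorem diagMetric_nondegenerate {ε : α → F} (hε : ∀ i, ε i ≠ 0) (b : Basis α F E) :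
    (diagMetric ε b).Nondegenerate := by
  refine Matrix.Nondegenerate.toBilin ?_ b
  rw [Matrix.nondegenerate_iff_det_ne_zero, Matrix.det_diagonal]
  exact Finset.prod_ne_zero_iff.2 fun i _ => hε i

theorem diagMetric_one_self_ne_zero [LinearOrder F] [IsStrictOrderedRing F] (b : Basis α F E)
    {v : E} (hv : v ≠ 0) : diagMetric 1 b v v ≠ 0 := by
  intro h
  simp only [diagMetric_apply, Pi.one_apply, one_mul] at h
  rw [Finset.sum_eq_zero_iff_of_nonneg fun i _ => mul_self_nonneg _] at h
  exact hv (b.ext_elem fun i => by simpa using h i (Finset.mem_univ i))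

theorem two_mul_finrank_le_of_isotropic [NeZero (2 : F)] [FiniteDimensional F E]
    {g : LinearMap.BilinForm F E} (hg : g.Nondegenerate) (hsymm : g.IsSymm) {P : Submodule F E}
    (hP : ∀ v ∈ P, g v v = 0) : 2 * finrank F P ≤ finrank F E := by
  have hle : P ≤ g.orthogonal P := by
    intro w hw u hu
    have := hP (u + w) (P.add_mem hu hw)
    rw [map_add, map_add, LinearMap.add_apply, LinearMap.add_apply, hP w hw, hP u hu,
      hsymm.eq w u, zero_add, add_zero, ← two_mul] at this
    exact (mul_eq_zero.1 this).resolve_left two_ne_zero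
  have := Submodule.finrank_mono hle
  rw [LinearMap.BilinForm.finrank_orthogonal hg] at this
  have := P.finrank_le
  omega

theorem ιMulti_basis_ne_zero {n : ℕ} (b : Basis (Fin n) F E) :
    exteriorPower.ιMulti F n b ≠ 0 := by
  intro h
  have := exteriorPower.alternatingMapLinearEquiv_apply_ιMulti b.det b
  rw [h, map_zero, b.det_self] at this
  exact zero_ne_one this

end DiagonalMetric

section FourForm

variable {F E : Type*} [Field F] [AddCommGroup E] [Module F E]

theorem coe_ιMulti_three (v₀ v₁ v₂ : E) :
    (exteriorPower.ιMulti F 3 ![v₀, v₁, v₂] : ExteriorAlgebra F E) =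
      ι F v₀ * (ι F v₁ * ι F v₂) := by
  simp [ExteriorAlgebra.ιMulti_apply]

theorem coe_ιMulti_four (v₀ v₁ v₂ v₃ : E) :
    (exteriorPower.ιMulti F 4 ![v₀, v₁, v₂, v₃] : ExteriorAlgebra F E) =
      ι F v₀ * (ι F v₁ * (ι F v₂ * ι F v₃)) := by
  simp [ExteriorAlgebra.ιMulti_apply]

theorem coe_ιMulti_seven (b : Fin 7 → E) :
    (exteriorPower.ιMulti F 7 b : ExteriorAlgebra F E) = ι F (b 0) * (ι F (b 1) * (ι F (b 2) *
      (ι F (b 3) * (ι F (b 4) * (ι F (b 5) * ι F (b 6)))))) := by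
  rw [exteriorPower.ιMulti_apply_coe, ExteriorAlgebra.ιMulti_apply]
  simp only [List.ofFn_succ, List.ofFn_zero, List.prod_cons, List.prod_nil, mul_one]
  rfl

/-- The three-form of a `G₂`-structure (`s = 1`) or `G₂*`-structure (`s = -1`), in terms of the
dual `b` of an adapted basis. -/
noncomputable def threeForm (s : F) (b : Fin 7 → E) : ⋀[F]^3 E :=
  s • exteriorPower.ιMulti F 3 ![b 0, b 1, b 6] + s • exteriorPower.ιMulti F 3 ![b 2, b 3, b 6]
    + exteriorPower.ιMulti F 3 ![b 4, b 5, b 6] + exteriorPower.ιMulti F 3 ![b 0, b 2, b 4]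
    - exteriorPower.ιMulti F 3 ![b 0, b 3, b 5] - exteriorPower.ιMulti F 3 ![b 1, b 2, b 5]
    - exteriorPower.ιMulti F 3 ![b 1, b 3, b 4]

/-- The Hodge dual of a `G₂`-structure (`s = 1`) or `G₂*`-structure (`s = -1`), in terms of the
dual `b` of an adapted basis. -/
noncomputable def fourForm (s : F) (b : Fin 7 → E) : ⋀[F]^4 E :=
  exteriorPower.ιMulti F 4 ![b 0, b 1, b 2, b 3]
    + s • exteriorPower.ιMulti F 4 ![b 0, b 1, b 4, b 5]
    + s • exteriorPower.ιMulti F 4 ![b 2, b 3, b 4, b 5]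
    + exteriorPower.ιMulti F 4 ![b 0, b 2, b 5, b 6]
    + exteriorPower.ιMulti F 4 ![b 0, b 3, b 4, b 6]
    + exteriorPower.ιMulti F 4 ![b 1, b 2, b 4, b 6]
    - exteriorPower.ιMulti F 4 ![b 1, b 3, b 5, b 6]

/-- The diagonal entries of the metric of a `G₂`-structure (`s = 1`) or `G₂*`-structure
(`s = -1`) in an adapted basis. -/
def metricSign (s : F) : Fin 7 → F := ![s, s, s, s, 1, 1, 1]

theorem metricSign_one : metricSign (1 : F) = 1 := by
  ext i
  fin_cases i <;> rfl

theorem metricSign_sq {s : F} (hs : s = 1 ∨ s = -1) (i : Fin 7) : metricSign s i ^ 2 = 1 := by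
  rcases hs with rfl | rfl <;> fin_cases i <;> simp [metricSign]

theorem metricSign_ne_zero {s : F} (hs : s = 1 ∨ s = -1) (i : Fin 7) : metricSign s i ≠ 0 :=
  fun h => by simpa [h] using metricSign_sq hs i

theorem prod_metricSign {s : F} (hs : s = 1 ∨ s = -1) : ∏ i, metricSign s i = 1 := by
  rcases hs with rfl | rfl <;> simp [Fin.prod_univ_seven, metricSign]

/-- The components of the covector `g(v × w, ·)` for the cross product `×` of the metric with
diagonal entries `metricSign s`. -/
def crossCovector (s : F) (v w : Fin 7 → F) : Fin 7 → F :=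
  ![s * v 1 * w 6 + v 2 * w 4 - v 3 * w 5 - v 4 * w 2 + v 5 * w 3 - s * v 6 * w 1,
    -(s * v 0 * w 6) - v 2 * w 5 - v 3 * w 4 + v 4 * w 3 + v 5 * w 2 + s * v 6 * w 0,
    -(v 0 * w 4) + v 1 * w 5 + s * v 3 * w 6 + v 4 * w 0 - v 5 * w 1 - s * v 6 * w 3,
    v 0 * w 5 + v 1 * w 4 - s * v 2 * w 6 - v 4 * w 1 - v 5 * w 0 + s * v 6 * w 2,
    v 0 * w 2 - v 1 * w 3 - v 2 * w 0 + v 3 * w 1 + v 5 * w 6 - v 6 * w 5,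
    -(v 0 * w 3) - v 1 * w 2 + v 2 * w 1 + v 3 * w 0 - v 4 * w 6 + v 6 * w 4,
    s * v 0 * w 1 - s * v 1 * w 0 + s * v 2 * w 3 - s * v 3 * w 2 + v 4 * w 5 - v 5 * w 4]

theorem ι_mul_ι_mul_ι_mul_fourForm (s : F) (b : Fin 7 → E) (v w : Fin 7 → F) (j : Fin 7) :
    ι F (b j) * (ι F (∑ i, v i • b i) * (ι F (∑ i, w i • b i) *
      (fourForm s b : ExteriorAlgebra F E))) =
      crossCovector s v w j • (exteriorPower.ιMulti F 7 b : ExteriorAlgebra F E) := by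
  simp only [fourForm, Fin.sum_univ_seven, Submodule.coe_add, Submodule.coe_sub, Submodule.coe_smul,
    coe_ιMulti_four, map_add, map_smul, add_mul, mul_add, mul_sub, smul_mul_assoc, mul_smul_comm]
  -- The guards `i < j` turn anticommutativity into sorting of the factors.
  have hswap (i j) (_ : i < j) := ι_mul_ι_swap (R := F) (b j) (b i)
  have hswap_mul (i j) (_ : i < j) := ι_mul_ι_mul_swap (R := F) (b j) (b i)
  simp (discharger := decide) only [hswap, hswap_mul, ι_sq_zero, ι_mul_ι_mul_self,
    mul_neg, neg_neg, mul_zero, smul_zero, neg_zero, add_zero, zero_add, smul_neg]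
  rw [coe_ιMulti_seven]
  fin_cases j <;>
  simp (discharger := decide) only [Fin.zero_eta, Fin.mk_one, Fin.reduceFinMk, crossCovector,
    hswap, hswap_mul, ι_sq_zero, ι_mul_ι_mul_self, mul_neg, neg_neg, mul_zero,
    smul_zero, neg_zero, add_zero, zero_add, smul_neg, sub_zero, Matrix.cons_val] <;>
  module

/-- The cross product in coordinates: `crossCovector` with its index raised. -/
def cross (s : F) (v w : Fin 7 → F) : Fin 7 → F := metricSign s * crossCovector s v w

theorem cross_cross {s : F} (hs : s = 1 ∨ s = -1) (v w : Fin 7 → F) :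
    cross s v (cross s v w) =
      (∑ i, metricSign s i * v i * w i) • v - (∑ i, metricSign s i * v i * v i) • w := by
  ext j
  simp only [Fin.sum_univ_seven, Pi.sub_apply, Pi.smul_apply, smul_eq_mul]
  rcases hs with rfl | rfl <;> fin_cases j <;>
    simp only [cross, crossCovector, metricSign, Pi.mul_apply, Matrix.cons_val, Fin.zero_eta,
      Fin.mk_one, Fin.reduceFinMk] <;>
    ring

theorem cross_zero (s : F) (v : Fin 7 → F) : cross s v 0 = 0 := by
  ext j
  fin_cases j <;> simp [cross, crossCovector]

theorem cross_eq_zero_of_ι_mul_ι_mul_fourForm_eq_zero {s : F} (b : Basis (Fin 7) F E) {v w : E}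
    (h : ι F v * (ι F w * (fourForm s b : ExteriorAlgebra F E)) = 0) :
    cross s (b.repr v) (b.repr w) = 0 := by
  have hcovector : crossCovector s (b.repr v) (b.repr w) = 0 := by
    ext j
    have hj := ι_mul_ι_mul_ι_mul_fourForm s b (b.repr v) (b.repr w) j
    rw [b.sum_repr, b.sum_repr, h, mul_zero] at hj
    exact (smul_eq_zero.1 hj.symm).resolve_right
      ((Submodule.coe_eq_zero (x := exteriorPower.ιMulti F 7 b)).not.2 (ιMulti_basis_ne_zero b))
  rw [cross, hcovector, mul_zero]

theorem metric_self_smul_eq_of_ι_mul_ι_mul_fourForm_eq_zero {s : F} (hs : s = 1 ∨ s = -1)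
    (b : Basis (Fin 7) F E) {v w : E}
    (h : ι F v * (ι F w * (fourForm s b : ExteriorAlgebra F E)) = 0) :
    diagMetric (metricSign s) b v v • w = diagMetric (metricSign s) b v w • v := by
  have hcross := cross_cross hs (b.repr v) (b.repr w)
  rw [cross_eq_zero_of_ι_mul_ι_mul_fourForm_eq_zero b h, cross_zero, ← diagMetric_apply,
    ← diagMetric_apply, eq_comm, sub_eq_zero] at hcross
  exact b.ext_elem fun i => by simpa using (congrFun hcross i).symm

theorem six_le_wedgeRank_ι_mul_fourForm {s : F} (hs : s = 1 ∨ s = -1) (b : Basis (Fin 7) F E)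
    {v : E} (hv : diagMetric (metricSign s) b v v ≠ 0) :
    6 ≤ wedgeRank (ι F v * (fourForm s b : ExteriorAlgebra F E)) := by
  have : FiniteDimensional F E := b.finiteDimensional_of_finite
  set f := wedge (ι F v * (fourForm s b : ExteriorAlgebra F E)) with hf
  have hker : f.ker ≤ Submodule.span F {v} := by
    intro w hw
    rw [LinearMap.mem_ker, hf, wedge_apply, ι_mul_ι_mul_swap, neg_eq_zero] at hw
    have := metric_self_smul_eq_of_ι_mul_ι_mul_fourForm_eq_zero hs b hw
    exact (Submodule.smul_mem_iff _ hv).1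
      (this ▸ Submodule.smul_mem _ _ (Submodule.mem_span_singleton_self v))
  have h1 := (Submodule.finrank_mono hker).trans (finrank_span_le_card {v})
  have h7 := f.finrank_range_add_finrank_ker
  rw [finrank_eq_card_basis b, Fintype.card_fin] at h7
  rw [Set.toFinset_singleton, Finset.card_singleton] at h1
  change 6 ≤ finrank F f.range
  omega

theorem four_le_wedgeRank_ι_mul_fourForm [NeZero (2 : F)] {s : F} (hs : s = 1 ∨ s = -1)
    (b : Basis (Fin 7) F E) {v : E} (hv : v ≠ 0) :
    4 ≤ wedgeRank (ι F v * (fourForm s b : ExteriorAlgebra F E)) := by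
  have : FiniteDimensional F E := b.finiteDimensional_of_finite
  by_cases hvv : diagMetric (metricSign s) b v v = 0
  · set f := wedge (ι F v * (fourForm s b : ExteriorAlgebra F E)) with hf
    have hsymm := diagMetric_isSymm (metricSign s) b
    have hisotropic : ∀ w ∈ f.ker, diagMetric (metricSign s) b w w = 0 := by
      intro w hw
      rw [LinearMap.mem_ker, hf, wedge_apply] at hw
      have hwv := metric_self_smul_eq_of_ι_mul_ι_mul_fourForm_eq_zero hs b hw
      rw [ι_mul_ι_mul_swap, neg_eq_zero] at hw
      have hvw := metric_self_smul_eq_of_ι_mul_ι_mul_fourForm_eq_zero hs b hw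
      rw [hvv, zero_smul] at hvw
      rw [hsymm.eq w v, (smul_eq_zero.1 hvw.symm).resolve_right hv,
        zero_smul] at hwv
      exact (smul_eq_zero.1 hwv).resolve_right hv
    have h3 := two_mul_finrank_le_of_isotropic
      (diagMetric_nondegenerate (metricSign_ne_zero hs) b) hsymm hisotropic
    have h7 := f.finrank_range_add_finrank_ker
    rw [finrank_eq_card_basis b, Fintype.card_fin] at h3 h7
    change 4 ≤ finrank F f.range
    omega
  · exact (by norm_num : 4 ≤ 6).trans (six_le_wedgeRank_ι_mul_fourForm hs b hvv)

theorem length_sum_ιMulti_le {k n : ℕ} (a : Fin n → Fin k → E) :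
    length (∑ i, exteriorPower.ιMulti F k (a i)) ≤ n :=
  (length_sum_le _ fun i _ => ⟨a i, rfl⟩).trans (by simp)

theorem length_fourForm_one_le (b : Fin 7 → E) : length (fourForm (1 : F) b) ≤ 5 := by
  have hsum : fourForm (1 : F) b = ∑ i, exteriorPower.ιMulti F 4
      (![![-b 1, b 3 + b 4, b 2 + b 5, b 6], ![b 0, b 3 + b 5, b 4 - b 2, b 6],
        ![b 0 + b 6, b 1 - b 6, b 2, b 3], ![b 0 - b 6, b 1 + b 6, b 4, b 5],
        ![b 2, b 3, b 4, b 5]] i) := by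
    apply Subtype.ext
    simp only [fourForm, Fin.sum_univ_five, Matrix.cons_val, Submodule.coe_add, Submodule.coe_sub,
      coe_ιMulti_four, map_add, map_sub, map_neg, add_mul, mul_add, mul_sub,
      sub_mul, neg_mul, one_smul]
    have hswap (i j) (_ : i < j) := ι_mul_ι_swap (R := F) (b j) (b i)
    have hswap_mul (i j) (_ : i < j) := ι_mul_ι_mul_swap (R := F) (b j) (b i)
    simp (discharger := decide) only [hswap, hswap_mul, ι_sq_zero, mul_neg,
      neg_neg, mul_zero, neg_zero, add_zero, sub_zero]
    abel
  exact hsum ▸ length_sum_ιMulti_le _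

theorem isSplitting_fourForm_one (b : Basis (Fin 7) F E) (htop : support (fourForm (1 : F) b) = ⊤) :
    IsSplitting (fourForm (1 : F) b) (b 6) (LinearMap.ker (b.coord 6))
      (∑ i, exteriorPower.ιMulti F 3 (![![b 0, b 3 + b 2, b 5 + b 4], ![-(b 1 + b 0), b 3, b 5],
        ![b 1 - b 0, b 2, b 4]] i))
      (∑ i, exteriorPower.ιMulti F 4 (![![b 0, b 1, b 2, b 3], ![b 0, b 1, b 4, b 5],
        ![b 2, b 3, b 4, b 5]] i)) := by
  refine isSplitting_ker htop (by simp)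
    (Submodule.sum_mem _ fun i _ => ιMulti_mem_subPower fun j => ?_)
    (Submodule.sum_mem _ fun i _ => ιMulti_mem_subPower fun j => ?_) ?_
  · fin_cases i <;> fin_cases j <;> simp
  · fin_cases i <;> fin_cases j <;> simp
  · simp only [fourForm, Fin.sum_univ_three, Matrix.cons_val, Submodule.coe_add,
      Submodule.coe_sub, coe_ιMulti_four, coe_ιMulti_three, map_add, map_sub,
      map_neg, add_mul, mul_add, sub_mul, neg_mul, one_smul, mul_assoc]
    abel

theorem invariants_fourForm_one [LinearOrder F] [IsStrictOrderedRing F] (b : Basis (Fin 7) F E) :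
    (rank (fourForm (1 : F) b), length (fourForm (1 : F) b), invM (fourForm (1 : F) b),
      invR (fourForm (1 : F) b)) = (7, 5, 3, 3) := by
  have : FiniteDimensional F E := b.finiteDimensional_of_finite
  refine invariants_eq_of_le_wedgeRank le_rfl
    (by rw [finrank_eq_card_basis b, Fintype.card_fin]) (by norm_num)
    (fun v hv => six_le_wedgeRank_ι_mul_fourForm (Or.inl rfl) b ?_) (length_fourForm_one_le b)
    (fun htop => ⟨_, ⟨_, _, _, isSplitting_fourForm_one b htop⟩, length_sum_ιMulti_le _⟩)
    (fun htop => ⟨_, ⟨_, _, _, isSplitting_fourForm_one b htop⟩, length_sum_ιMulti_le _⟩)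
  exact metricSign_one (F := F) ▸ diagMetric_one_self_ne_zero b hv

/-- The normal form `a ∧ (x₀ ∧ x₁ ∧ x₂ + y₀ ∧ y₁ ∧ y₂) + κ ∑_{i < j} xᵢ ∧ yᵢ ∧ xⱼ ∧ yⱼ`, in which
the `G₂*`- and the complex `G₂`-case coincide. -/
noncomputable def splitFourForm (κ : F) (a : E) (x y : Fin 3 → E) : ⋀[F]^4 E :=
  exteriorPower.ιMulti F 4 ![a, x 0, x 1, x 2] + exteriorPower.ιMulti F 4 ![a, y 0, y 1, y 2]
    + κ • (exteriorPower.ιMulti F 4 ![x 0, y 0, x 1, y 1]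
      + exteriorPower.ιMulti F 4 ![x 0, y 0, x 2, y 2]
      + exteriorPower.ιMulti F 4 ![x 1, y 1, x 2, y 2])

theorem length_splitFourForm_le (κ : F) (a : E) (x y : Fin 3 → E) :
    length (splitFourForm κ a x y) ≤ 4 := by
  -- `x₁ ∧ y₁ + x₂ ∧ y₂ = (x₁ + y₂) ∧ (y₁ - x₂) + x₁ ∧ x₂ + y₁ ∧ y₂`, and the multiples of the last
  -- two terms can be absorbed in `a ∧ x₀ ∧ x₁ ∧ x₂` and `a ∧ y₀ ∧ y₁ ∧ y₂`.
  have hsum : splitFourForm κ a x y = ∑ i, exteriorPower.ιMulti F 4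
      (![![a - κ • y 0, x 0, x 1, x 2], ![a + κ • x 0, y 0, y 1, y 2],
        ![κ • x 0, y 0, x 1 + y 2, y 1 - x 2], ![κ • x 1, y 1, x 2, y 2]] i) := by
    apply Subtype.ext
    simp only [splitFourForm, Fin.sum_univ_four, Matrix.cons_val, Submodule.coe_add,
      Submodule.coe_smul, coe_ιMulti_four, map_add, map_sub, map_smul, add_mul, sub_mul, mul_add,
      mul_sub, mul_neg, smul_mul_assoc, ι_mul_ι_mul_swap (y 0) (x 0), ι_mul_ι_swap (y 2) (y 1),
      ι_mul_ι_swap (y 2) (x 2)]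
    module
  exact hsum ▸ length_sum_ιMulti_le _

theorem exists_mem_setD_splitFourForm {κ : F} {a : E} {x y : Fin 3 → E}
    (htop : support (splitFourForm κ a x y) = ⊤) {ξ : Dual F E} (ha : ξ a ≠ 0)
    (hx : ∀ i, ξ (x i) = 0) (hy : ∀ i, ξ (y i) = 0) :
    ∃ X₁ ∈ setD (splitFourForm κ a x y), length X₁ ≤ 2 := by
  refine ⟨∑ i, exteriorPower.ιMulti F 3 (![![-x 0, x 1, x 2], ![-y 0, y 1, y 2]] i),
    ⟨a, _, κ • ∑ i, exteriorPower.ιMulti F 4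
      (![![x 0, y 0, x 1, y 1], ![x 0, y 0, x 2, y 2], ![x 1, y 1, x 2, y 2]] i),
      isSplitting_ker htop ha
        (Submodule.sum_mem _ fun i _ => ιMulti_mem_subPower fun j => ?_)
        (Submodule.smul_mem _ _ <| Submodule.sum_mem _ fun i _ => ιMulti_mem_subPower fun j => ?_)
        ?_⟩, length_sum_ιMulti_le _⟩
  · fin_cases i <;> fin_cases j <;> simp [hx, hy]
  · fin_cases i <;> fin_cases j <;> simp [hx, hy]
  · simp only [splitFourForm, Fin.sum_univ_two, Fin.sum_univ_three, Matrix.cons_val,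
      Submodule.coe_add, Submodule.coe_smul, coe_ιMulti_four, coe_ιMulti_three, map_neg, add_mul,
      neg_mul, mul_assoc, ι_mul_ι_swap _ a, ι_mul_ι_mul_swap _ a, mul_neg, neg_neg]

theorem exists_mem_setE_splitFourForm {κ : F} {a : E} {x y : Fin 3 → E}
    (htop : support (splitFourForm κ a x y) = ⊤) {ξ : Dual F E} (ha : ξ a = 0)
    (hx₀ : ξ (x 0) ≠ 0) (hx₁ : ξ (x 1) = 0) (hx₂ : ξ (x 2) = 0) (hy : ∀ i, ξ (y i) = 0) :
    ∃ X₂ ∈ setE (splitFourForm κ a x y), length X₂ ≤ 2 := by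
  refine ⟨∑ i, exteriorPower.ιMulti F 4 (![![a, y 0, y 1, y 2], ![κ • x 1, y 1, x 2, y 2]] i),
    ⟨x 0, _, ∑ i, exteriorPower.ιMulti F 3
      (![![a, x 1, x 2], ![-(κ • y 0), x 1, y 1], ![-(κ • y 0), x 2, y 2]] i),
      isSplitting_ker htop hx₀
        (Submodule.sum_mem _ fun i _ => ιMulti_mem_subPower fun j => ?_)
        (Submodule.sum_mem _ fun i _ => ιMulti_mem_subPower fun j => ?_) ?_⟩,
    length_sum_ιMulti_le _⟩
  · fin_cases i <;> fin_cases j <;> simp [ha, hx₁, hx₂, hy]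
  · fin_cases i <;> fin_cases j <;> simp [ha, hx₁, hx₂, hy]
  · simp only [splitFourForm, Fin.sum_univ_two, Fin.sum_univ_three, Matrix.cons_val,
      Submodule.coe_add, Submodule.coe_smul, coe_ιMulti_four, coe_ιMulti_three, map_neg, map_smul,
      add_mul, neg_mul, smul_mul_assoc, mul_assoc, ι_mul_ι_swap _ (x 0), ι_mul_ι_mul_swap _ (x 0),
      mul_neg, neg_neg]
    module

theorem fourForm_eq_splitFourForm [NeZero (2 : F)] {s t : F} (hs : s = 1 ∨ s = -1)
    (ht : t ^ 2 = -s) (b : Fin 7 → E) :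
    fourForm s b = splitFourForm (-1 / 4) (-(t / 2) • b 0)
      ![t • b 1 + b 6, t • b 3 - s • b 5, t • b 2 + s • b 4]
      ![t • b 1 - b 6, t • b 3 + s • b 5, t • b 2 - s • b 4] := by
  -- The entries of the two triples span the eigenspaces of the cross product with `b 0`, whose
  -- square is `-s = t ^ 2` on the complement of `b 0`.
  apply Subtype.ext
  simp only [fourForm, splitFourForm, Matrix.cons_val, Submodule.coe_add, Submodule.coe_sub,
    Submodule.coe_smul, coe_ιMulti_four, map_add, map_sub, map_smul, add_mul, mul_add,
    mul_sub, sub_mul, smul_mul_assoc, mul_smul_comm]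
  have hswap (i j) (_ : i < j) := ι_mul_ι_swap (R := F) (b j) (b i)
  have hswap_mul (i j) (_ : i < j) := ι_mul_ι_mul_swap (R := F) (b j) (b i)
  simp (discharger := decide) only [hswap, hswap_mul, ι_sq_zero, ι_mul_ι_mul_self,
    mul_neg, neg_neg, mul_zero, neg_zero, add_zero, zero_add, sub_zero, smul_neg, smul_zero]
  have h2 : (2 : F) ≠ 0 := two_ne_zero
  have h4 : (4 : F) ≠ 0 := by simpa [show (4 : F) = 2 * 2 by norm_num] using h2
  have hs2 : s ^ 2 = 1 := by rcases hs with rfl | rfl <;> norm_num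
  match_scalars <;> field_simp <;> grind

theorem invariants_fourForm_of_sq_eq [NeZero (2 : F)] {s t : F} (hs : s = 1 ∨ s = -1)
    (ht : t ^ 2 = -s) (b : Basis (Fin 7) F E) :
    (rank (fourForm s b), length (fourForm s b), invM (fourForm s b), invR (fourForm s b)) =
      (7, 4, 2, 2) := by
  have : FiniteDimensional F E := b.finiteDimensional_of_finite
  have ht0 : t ≠ 0 := by rintro rfl; rcases hs with rfl | rfl <;> simp at ht
  have h2 : (2 : F) ≠ 0 := two_ne_zero
  have hsplit := fourForm_eq_splitFourForm hs ht b
  refine invariants_eq_of_le_wedgeRank le_rfl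
    (by rw [finrank_eq_card_basis b, Fintype.card_fin]) le_rfl
    (fun v hv => four_le_wedgeRank_ι_mul_fourForm hs b hv) (hsplit ▸ length_splitFourForm_le ..)
    (fun htop => ?_) fun htop => ?_
  · rw [hsplit] at htop ⊢
    refine exists_mem_setD_splitFourForm htop (ξ := b.coord 0) ?_ (fun i => ?_) fun i => ?_
    · simp [ht0, h2]
    · fin_cases i <;> simp
    · fin_cases i <;> simp
  · rw [hsplit] at htop ⊢
    refine exists_mem_setE_splitFourForm htop (ξ := b.coord 1 + t • b.coord 6) ?_ ?_ ?_ ?_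
      fun i => ?_
    · simp
    · simp [ht0, h2, ← two_mul]
    · simp
    · simp
    · fin_cases i <;> simp

end FourForm

section HodgeStar

variable {F V : Type*} [Field F] [AddCommGroup V] [Module F V]

theorem ιMulti_coord_ne_zero {n : ℕ} (e : Basis (Fin n) F V) :
    exteriorPower.ιMulti F n e.coord ≠ 0 :=
  have := e.finiteDimensional_of_finite
  e.coe_dualBasis ▸ ιMulti_basis_ne_zero e.dualBasis

theorem ιMulti_eq_det_smul_ιMulti_coord {n : ℕ} (e : Basis (Fin n) F V) (c : Fin n → Dual F V) :
    exteriorPower.ιMulti F n c =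
      (Matrix.of fun i j => c i (e j)).det • exteriorPower.ιMulti F n e.coord := by
  have := e.finiteDimensional_of_finite
  obtain ⟨r, hr⟩ := exists_smul_eq (by rw [finrank_eq_card_basis e, Fintype.card_fin])
    (ιMulti_coord_ne_zero e) _ (exteriorPower.ιMulti F n c).2
  have hr : r • exteriorPower.ιMulti F n e.coord = exteriorPower.ιMulti F n c := Subtype.ext hr
  have hpair := congrArg
    (fun x => exteriorPower.pairingDual F V n x (exteriorPower.ιMulti F n e)) hr
  have hone : (Matrix.of fun i j => e.coord j (e i)) = (1 : Matrix (Fin n) (Fin n) F) := by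
    ext i j
    simp [Matrix.one_apply, Finsupp.single_apply]
  simp only [map_smul, LinearMap.smul_apply, exteriorPower.pairingDual_ιMulti_ιMulti, hone,
    Matrix.det_one, smul_eq_mul, mul_one] at hpair
  rw [← hr, hpair, ← Matrix.det_transpose]
  rfl

theorem ιMulti_coord_mul_ιMulti {k l : ℕ} (e : Basis (Fin (k + l)) F V)
    (τ : Equiv.Perm (Fin (k + l))) (c : Fin l → Dual F V) :
    (exteriorPower.ιMulti F k (fun i => e.coord (τ (Fin.castAdd l i))) :
        ExteriorAlgebra F (Dual F V)) * exteriorPower.ιMulti F l c =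
      ((Equiv.Perm.sign τ : F) * (Matrix.of fun i j => c i (e (τ (Fin.natAdd k j)))).det) •
        (exteriorPower.ιMulti F (k + l) e.coord : ExteriorAlgebra F (Dual F V)) := by
  set a := Fin.append (fun i => e.coord (τ (Fin.castAdd l i))) c with ha
  have hblocks : ((Matrix.of fun i j => a i (e j)).submatrix id τ).submatrix
      finSumFinEquiv finSumFinEquiv =
      Matrix.fromBlocks 1 0 (Matrix.of fun i j => c i (e (τ (Fin.castAdd l j))))
        (Matrix.of fun i j => c i (e (τ (Fin.natAdd k j)))) := by
    ext i j
    have hne (i : Fin k) (j : Fin l) : Fin.natAdd k j ≠ Fin.castAdd l i := by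
      simp only [ne_eq, Fin.ext_iff, Fin.val_natAdd, Fin.val_castAdd]
      omega
    rcases i with i | i <;> rcases j with j | j <;>
      simp [ha, Matrix.one_apply, Finsupp.single_apply, hne, eq_comm (a := i)]
  have hdet : (Matrix.of fun i j => a i (e j)).det =
      Equiv.Perm.sign τ * (Matrix.of fun i j => c i (e (τ (Fin.natAdd k j)))).det := by
    have hsign : ((Equiv.Perm.sign τ : ℤ) : F) * (Equiv.Perm.sign τ : ℤ) = 1 := by
      rw [← Int.cast_mul, ← Units.val_mul, Int.units_mul_self, Units.val_one, Int.cast_one]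
    have := Matrix.det_permute' τ (Matrix.of fun i j => a i (e j))
    rw [← Matrix.det_submatrix_equiv_self finSumFinEquiv, hblocks, Matrix.det_fromBlocks_zero₁₂,
      Matrix.det_one, one_mul] at this
    rw [this, ← mul_assoc, hsign, one_mul]
  rw [exteriorPower.ιMulti_apply_coe, exteriorPower.ιMulti_apply_coe,
    ExteriorAlgebra.ιMulti_mul_ιMulti, ← ha, ← hdet, ← Submodule.coe_smul,
    ← ιMulti_eq_det_smul_ιMulti_coord]
  rfl

theorem mul_coord_sharp_diagMetric [FiniteDimensional F V] {α : Type*} [Fintype α] [DecidableEq α]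
    {ε : α → F} (hε : ∀ i, ε i ≠ 0) (e : Basis α F V) (ξ : Dual F V) (i : α) :
    ε i * e.coord i (sharp (diagMetric ε e) ξ) = ξ (e i) := by
  have h : diagMetric ε e (sharp (diagMetric ε e) ξ) (e i) = ξ (e i) := by
    rw [sharp, dif_pos (diagMetric_nondegenerate hε e)]
    exact LinearMap.BilinForm.apply_toDual_symm_apply ξ (e i)
  rwa [diagMetric_apply, Finset.sum_eq_single i (fun j _ hj => by simp [hj.symm]) (by simp),
    Basis.repr_self, Finsupp.single_eq_same, mul_one] at h

namespace IsHodgeDual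

variable [FiniteDimensional F V] {g : LinearMap.BilinForm F V} {n k l : ℕ} {vol : Form F V n}
  {ψ ψ' : Form F V k} {Ψ Ψ' : Form F V l}

theorem add (h : IsHodgeDual g vol ψ Ψ) (h' : IsHodgeDual g vol ψ' Ψ') :
    IsHodgeDual g vol (ψ + ψ') (Ψ + Ψ') := fun χ => by
  rw [Submodule.coe_add, add_mul, h χ, h' χ, ← add_smul, formInner, formInner, formInner, map_add,
    LinearMap.add_apply]

theorem smul (a : F) (h : IsHodgeDual g vol ψ Ψ) : IsHodgeDual g vol (a • ψ) (a • Ψ) := fun χ => by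
  rw [Submodule.coe_smul, smul_mul_assoc, h χ, smul_smul, formInner, formInner, map_smul,
    LinearMap.smul_apply, smul_eq_mul]

theorem sub (h : IsHodgeDual g vol ψ Ψ) (h' : IsHodgeDual g vol ψ' Ψ') :
    IsHodgeDual g vol (ψ - ψ') (Ψ - Ψ') := fun χ => by
  rw [Submodule.coe_sub, sub_mul, h χ, h' χ, ← sub_smul, formInner, formInner, formInner, map_sub,
    LinearMap.sub_apply]

theorem of_ιMulti (h : ∀ c : Fin l → Dual F V,
    (ψ : ExteriorAlgebra F (Dual F V)) * exteriorPower.ιMulti F l c =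
      formInner g Ψ (exteriorPower.ιMulti F l c) • (vol : ExteriorAlgebra F (Dual F V))) :
    IsHodgeDual g vol ψ Ψ := by
  intro χ
  have hχ : χ ∈ Submodule.span F (Set.range (exteriorPower.ιMulti F l (M := Dual F V))) := by
    rw [exteriorPower.ιMulti_span]; trivial
  induction hχ using Submodule.span_induction with
  | zero => simp [formInner]
  | add x y _ _ hx hy =>
    rw [Submodule.coe_add, mul_add, hx, hy, ← add_smul, formInner, formInner, formInner, map_add,
      map_add]
  | smul a x _ hx =>
    rw [Submodule.coe_smul, mul_smul_comm, hx, smul_smul, formInner, formInner, map_smul, map_smul,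
      smul_eq_mul]
  | mem x hx =>
    obtain ⟨c, rfl⟩ := hx
    exact h c

theorem hodgeStar_eq (h : IsHodgeDual g vol ψ Ψ) (hg : g.Nondegenerate) (hn : finrank F V = n)
    (hkl : k + l = n) (hvol : vol ≠ 0) : hodgeStar g vol ψ = Ψ := by
  have hex : ∃ Ψ : Form F V l, IsHodgeDual g vol ψ Ψ := ⟨Ψ, h⟩
  rw [hodgeStar, dif_pos hex]
  exact (existsUnique_isHodgeDual hg hn hkl hvol ψ).unique hex.choose_spec h

end IsHodgeDual

theorem isHodgeDual_ιMulti_coord [FiniteDimensional F V] {k l : ℕ} {ε : Fin (k + l) → F}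
    (hε : ∀ i, ε i ≠ 0) (e : Basis (Fin (k + l)) F V) (τ : Equiv.Perm (Fin (k + l))) :
    IsHodgeDual (diagMetric ε e) (exteriorPower.ιMulti F (k + l) e.coord)
      (exteriorPower.ιMulti F k fun i => e.coord (τ (Fin.castAdd l i)))
      (((Equiv.Perm.sign τ : F) * ∏ j, ε (τ (Fin.natAdd k j))) •
        exteriorPower.ιMulti F l fun j => e.coord (τ (Fin.natAdd k j))) := by
  refine .of_ιMulti fun c => ?_
  have hrow := Matrix.det_mul_row (fun j => ε (τ (Fin.natAdd k j)))
    (Matrix.of fun i j => e.coord (τ (Fin.natAdd k j)) (sharp (diagMetric ε e) (c i)))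
  simp only [Matrix.of_apply, mul_coord_sharp_diagMetric hε] at hrow
  rw [ιMulti_coord_mul_ιMulti, hrow, formInner, map_smul, LinearMap.smul_apply,
    exteriorPower.map_apply_ιMulti, exteriorPower.pairingDual_ιMulti_ιMulti, smul_eq_mul, mul_assoc]
  rfl

theorem isHodgeDual_ιMulti_coord_three [FiniteDimensional F V] {ε : Fin 7 → F} (hε : ∀ i, ε i ≠ 0)
    (e : Basis (Fin 7) F V) (i : Fin 7 → Fin 7) {σ : ℤˣ} (τ : Equiv.Perm (Fin 7)) (hτ : τ = i)
    (hσ : Equiv.Perm.sign τ = σ) :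
    IsHodgeDual (diagMetric ε e) (e7 e)
      (exteriorPower.ιMulti F 3 ![e.coord (i 0), e.coord (i 1), e.coord (i 2)])
      (((σ : ℤ) * (ε (i 3) * ε (i 4) * ε (i 5) * ε (i 6)) : F) •
        exteriorPower.ιMulti F 4
          ![e.coord (i 3), e.coord (i 4), e.coord (i 5), e.coord (i 6)]) := by
  subst hτ hσ
  convert isHodgeDual_ιMulti_coord (k := 3) (l := 4) hε e τ using 2
  · rfl
  · ext1 i; fin_cases i <;> rfl
  · rw [Fin.prod_univ_four]; rfl
  · congr 1; ext1 i; fin_cases i <;> rfl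

theorem isHodgeDual_fourForm [FiniteDimensional F V] {s : F} (hs : s = 1 ∨ s = -1)
    (e : Basis (Fin 7) F V) :
    IsHodgeDual (diagMetric (metricSign s) e) (e7 e) (threeForm s e.coord)
      (fourForm s e.coord) := by
  have hdual := isHodgeDual_ιMulti_coord_three (metricSign_ne_zero hs) e
  have h127 := hdual ![0, 1, 6, 2, 3, 4, 5] (σ := 1) c[2, 6, 5, 4, 3] (by decide) (by decide)
  have h347 := hdual ![2, 3, 6, 0, 1, 4, 5] (σ := 1) c[0, 2, 6, 5, 4, 1, 3] (by decide) (by decide)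
  have h567 := hdual ![4, 5, 6, 0, 1, 2, 3] (σ := 1) c[0, 4, 1, 5, 2, 6, 3] (by decide) (by decide)
  have h135 := hdual ![0, 2, 4, 1, 3, 5, 6] (σ := -1) c[1, 2, 4, 3] (by decide) (by decide)
  have h146 := hdual ![0, 3, 5, 1, 2, 4, 6] (σ := -1) (c[1, 3] * c[2, 5, 4]) (by decide) (by decide)
  have h236 := hdual ![1, 2, 5, 0, 3, 4, 6] (σ := -1) c[0, 1, 2, 5, 4, 3] (by decide) (by decide)
  have h245 := hdual ![1, 3, 4, 0, 2, 5, 6] (σ := -1) (c[0, 1, 3] * c[2, 4]) (by decide) (by decide)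
  simp only [Matrix.cons_val] at h127 h347 h567 h135 h146 h236 h245
  convert ((((((h127.smul s).add (h347.smul s)).add h567).add h135).sub h146).sub h236).sub h245
    using 1
  · rfl
  · apply Subtype.ext
    simp only [fourForm, metricSign, Matrix.cons_val, Submodule.coe_add, Submodule.coe_sub,
      Submodule.coe_smul]
    rcases hs with rfl | rfl <;> simp <;> abel

end HodgeStar

section MetricFormula

variable {F E : Type*} [Field F] [AddCommGroup E] [Module F E]

theorem contractLeft_ι_mul_ι_mul_ι (d : Dual F E) (x y z : E) :
    CliffordAlgebra.contractLeft d (ι F x * (ι F y * ι F z)) =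
      d x • (ι F y * ι F z) - d y • (ι F x * ι F z) + d z • (ι F x * ι F y) := by
  erw [CliffordAlgebra.contractLeft_ι_mul, CliffordAlgebra.contractLeft_ι_mul,
    CliffordAlgebra.contractLeft_ι]
  rw [mul_sub, mul_smul_comm, ← Algebra.commutes, ← Algebra.smul_def, mul_smul_comm]
  abel

theorem contractLeft_threeForm_mul_threeForm {s : F} (hs : s ^ 2 = 1) (b : Fin 7 → E)
    (d : Dual F E) :
    CliffordAlgebra.contractLeft d (threeForm s b : ExteriorAlgebra F E) *
        (threeForm s b : ExteriorAlgebra F E) =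
      (2 : F) • (ι F (∑ i, (metricSign s i * d (b i)) • b i) *
        (fourForm s b : ExteriorAlgebra F E)) := by
  simp only [threeForm, fourForm, Fin.sum_univ_seven, Submodule.coe_add, Submodule.coe_sub,
    Submodule.coe_smul, coe_ιMulti_three, coe_ιMulti_four, metricSign, Matrix.cons_val, one_mul,
    map_add, map_sub, map_smul, contractLeft_ι_mul_ι_mul_ι]
  simp only [add_mul, sub_mul, mul_add, mul_sub, smul_mul_assoc, mul_smul_comm, mul_assoc]
  have hswap (i j) (_ : i < j) := ι_mul_ι_swap (R := F) (b j) (b i)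
  have hswap_mul (i j) (_ : i < j) := ι_mul_ι_mul_swap (R := F) (b j) (b i)
  simp (discharger := decide) only [hswap, hswap_mul, ι_sq_zero,
    ι_mul_ι_mul_self, mul_neg, neg_neg, mul_zero, smul_zero, neg_zero, add_zero, zero_add,
    smul_neg, sub_zero, zero_sub, smul_add]
  match_scalars <;> grind

theorem contractLeft_threeForm_mul_ι_mul_fourForm {s : F} (hs : s ^ 2 = 1) (b : Fin 7 → E)
    (d : Dual F E) (c : Fin 7 → F) :
    CliffordAlgebra.contractLeft d (threeForm s b : ExteriorAlgebra F E) *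
        (ι F (∑ i, c i • b i) * (fourForm s b : ExteriorAlgebra F E)) =
      (3 * ∑ i, c i * d (b i)) • (exteriorPower.ιMulti F 7 b : ExteriorAlgebra F E) := by
  simp only [threeForm, fourForm, Fin.sum_univ_seven, Submodule.coe_add, Submodule.coe_sub,
    Submodule.coe_smul, coe_ιMulti_three, coe_ιMulti_four, coe_ιMulti_seven,
    map_add, map_sub, map_smul, contractLeft_ι_mul_ι_mul_ι]
  simp only [add_mul, sub_mul, mul_add, mul_sub, smul_mul_assoc, mul_smul_comm, mul_assoc]
  have hswap (i j) (_ : i < j) := ι_mul_ι_swap (R := F) (b j) (b i)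
  have hswap_mul (i j) (_ : i < j) := ι_mul_ι_mul_swap (R := F) (b j) (b i)
  simp (discharger := decide) only [hswap, hswap_mul, ι_sq_zero,
    ι_mul_ι_mul_self, mul_neg, neg_neg, mul_zero, smul_zero, neg_zero, add_zero, zero_add,
    smul_neg, sub_zero, zero_sub, smul_add]
  match_scalars
  grind

theorem contractLeft_threeForm_mul_contractLeft_threeForm_mul_threeForm {s : F} (hs : s ^ 2 = 1)
    (b : Fin 7 → E) (d d' : Dual F E) :
    CliffordAlgebra.contractLeft d (threeForm s b : ExteriorAlgebra F E) *
        (CliffordAlgebra.contractLeft d' (threeForm s b : ExteriorAlgebra F E) *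
          (threeForm s b : ExteriorAlgebra F E)) =
      (6 * ∑ i, metricSign s i * d (b i) * d' (b i)) •
        (exteriorPower.ιMulti F 7 b : ExteriorAlgebra F E) := by
  rw [contractLeft_threeForm_mul_threeForm hs, mul_smul_comm,
    contractLeft_threeForm_mul_ι_mul_fourForm hs, smul_smul, ← mul_assoc]
  norm_num [mul_right_comm]

end MetricFormula

section InducedMetric

variable {F V : Type*} [Field F] [AddCommGroup V] [Module F V]

theorem g2Form_eq_threeForm (e : Basis (Fin 7) F V) : g2Form e = threeForm 1 e.coord := by
  rw [threeForm, one_smul, one_smul]; rfl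

theorem g2StarForm_eq_threeForm (e : Basis (Fin 7) F V) :
    g2StarForm e = threeForm (-1) e.coord := by
  have hneg (x : Form F V 3) : (-1 : F) • x = -x := neg_one_smul F x
  rw [threeForm, hneg, hneg, ← sub_eq_add_neg]; rfl

theorem metricFormula_threeForm [CharZero F] {s : F} (hs : s = 1 ∨ s = -1)
    (e : Basis (Fin 7) F V) :
    MetricFormula (threeForm s e.coord) (diagMetric (metricSign s) e) (e7 e) := by
  intro v w
  have hs2 : s ^ 2 = 1 := by rcases hs with rfl | rfl <;> norm_num
  rw [contract, contract, mul_assoc,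
    contractLeft_threeForm_mul_contractLeft_threeForm_mul_threeForm hs2, smul_smul, ← mul_assoc,
    one_div_mul_cancel (by norm_num), one_mul, diagMetric_apply]
  rfl

/-- The determinant `d` of the change of basis satisfies `vol = d vol'` and `d g = g'`, so comparing
the determinants of `g` and `g'` shows `d ^ 9 = 1`. -/
theorem metric_eq_of_threeForm_eq [LinearOrder F] [IsStrictOrderedRing F] {s s' : F}
    (hs : s = 1 ∨ s = -1) (hs' : s' = 1 ∨ s' = -1) {e e' : Basis (Fin 7) F V}
    (h : threeForm s e.coord = threeForm s' e'.coord) :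
    diagMetric (metricSign s) e = diagMetric (metricSign s') e' ∧ e7 e = e7 e' := by
  have : FiniteDimensional F V := e.finiteDimensional_of_finite
  have hvol : e7 e = (e.toMatrix e').det • e7 e' := ιMulti_eq_det_smul_ιMulti_coord e' e.coord
  have hmetric : (e.toMatrix e').det • diagMetric (metricSign s) e =
      diagMetric (metricSign s') e' := by
    refine (existsUnique_metricFormula (by rw [finrank_eq_card_basis e, Fintype.card_fin])
      (ιMulti_coord_ne_zero e') (threeForm s' e'.coord)).unique (fun v w => ?_)
      (metricFormula_threeForm hs' e')
    rw [← h, ← metricFormula_threeForm hs e v w, hvol, Submodule.coe_smul, smul_smul,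
      LinearMap.smul_apply, LinearMap.smul_apply, smul_eq_mul, mul_comm]
    rfl
  have hdet := congrArg (fun g => (LinearMap.BilinForm.toMatrix e' g).det) hmetric
  simp only [map_smul] at hdet
  rw [diagMetric, diagMetric, LinearMap.BilinForm.toMatrix_toBilin, Matrix.det_diagonal,
    prod_metricSign hs', Matrix.det_smul, ← LinearMap.BilinForm.toMatrix_mul_basis_toMatrix e e',
    LinearMap.BilinForm.toMatrix_toBilin, Matrix.det_mul, Matrix.det_mul, Matrix.det_transpose,
    Matrix.det_diagonal, prod_metricSign hs, Fintype.card_fin] at hdet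
  have hpow : (e.toMatrix e').det ^ 9 = 1 ^ 9 := by rw [one_pow, ← hdet]; ring
  have hone : (e.toMatrix e').det = 1 := (Odd.strictMono_pow (by decide)).injective hpow
  rw [hone, one_smul] at hvol hmetric
  exact ⟨hmetric, hvol⟩

theorem isInducedMetric_threeForm {V : Type*} [AddCommGroup V] [Module ℝ V] {s : ℝ}
    (hs : s = 1 ∨ s = -1) (e : Basis (Fin 7) ℝ V) :
    IsInducedMetric (threeForm s e.coord) (diagMetric (metricSign s) e) (e7 e) := by
  have hadapted {e' : Basis (Fin 7) ℝ V} (he' : IsAdapted (threeForm s e.coord) e') :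
      ∃ s' : ℝ, (s' = 1 ∨ s' = -1) ∧
        diagMetric (metricSign s) e = diagMetric (metricSign s') e' ∧ e7 e = e7 e' := by
    rcases he' with h | h
    · exact ⟨1, Or.inl rfl, metric_eq_of_threeForm_eq hs (Or.inl rfl)
        (h.trans (g2Form_eq_threeForm e'))⟩
    · exact ⟨-1, Or.inr rfl, metric_eq_of_threeForm_eq hs (Or.inr rfl)
        (h.trans (g2StarForm_eq_threeForm e'))⟩
  refine ⟨metricFormula_threeForm hs e, fun e' he' i j hij => ?_, fun e' he' i => ?_,
    fun e' he' => ?_⟩ <;>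
  obtain ⟨s', hs', hmetric, hvol⟩ := hadapted he'
  · rw [hmetric, diagMetric_basis, if_neg hij]
  · rw [hmetric, diagMetric_basis, if_pos rfl]
    exact sq_eq_one_iff.1 (metricSign_sq hs' i)
  · exact hvol

theorem inducedMetric_threeForm {V : Type*} [AddCommGroup V] [Module ℝ V] {s : ℝ}
    (hs : s = 1 ∨ s = -1) (e : Basis (Fin 7) ℝ V) :
    inducedMetric (threeForm s e.coord) = (diagMetric (metricSign s) e, e7 e) := by
  have : FiniteDimensional ℝ V := e.finiteDimensional_of_finite
  have hex : ∃ p : LinearMap.BilinForm ℝ V × Form ℝ V 7,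
      IsInducedMetric (threeForm s e.coord) p.1 p.2 := ⟨(_, _), isInducedMetric_threeForm hs e⟩
  have hadapted : IsAdapted (threeForm s e.coord) e := by
    rcases hs with rfl | rfl
    · exact Or.inl (g2Form_eq_threeForm e).symm
    · exact Or.inr (g2StarForm_eq_threeForm e).symm
  have hvol : hex.choose.2 = e7 e := hex.choose_spec.oriented e hadapted
  have hformula : MetricFormula (threeForm s e.coord) hex.choose.1 (e7 e) :=
    hvol ▸ hex.choose_spec.formula
  rw [inducedMetric, dif_pos hex]
  refine Prod.ext ?_ hvol
  exact (existsUnique_metricFormula (by rw [finrank_eq_card_basis e, Fintype.card_fin])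
    (ιMulti_coord_ne_zero e) _).unique hformula
    (metricFormula_threeForm hs e)

theorem inducedMetricC_threeForm {W : Type*} [AddCommGroup W] [Module ℂ W]
    (e : Basis (Fin 7) ℂ W) :
    inducedMetricC (threeForm 1 e.coord) (e7 e) = diagMetric (metricSign 1) e := by
  have : FiniteDimensional ℂ W := e.finiteDimensional_of_finite
  have hformula := metricFormula_threeForm (Or.inl (rfl : (1 : ℂ) = 1)) e
  have hex : ∃ g : LinearMap.BilinForm ℂ W, MetricFormula (threeForm 1 e.coord) g (e7 e) :=
    ⟨_, hformula⟩
  rw [inducedMetricC, dif_pos hex]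
  exact (existsUnique_metricFormula (by rw [finrank_eq_card_basis e, Fintype.card_fin])
    (ιMulti_coord_ne_zero e) _).unique hex.choose_spec hformula

theorem hodgeStar_threeForm [FiniteDimensional F V] {s : F} (hs : s = 1 ∨ s = -1)
    (e : Basis (Fin 7) F V) :
    hodgeStar (diagMetric (metricSign s) e) (e7 e) (threeForm s e.coord) = fourForm s e.coord :=
  (isHodgeDual_fourForm hs e).hodgeStar_eq (diagMetric_nondegenerate (metricSign_ne_zero hs) e)
    (by rw [finrank_eq_card_basis e, Fintype.card_fin]) rfl (ιMulti_coord_ne_zero e)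

theorem hodgeDual_g2Form {V : Type*} [AddCommGroup V] [Module ℝ V] [FiniteDimensional ℝ V]
    (e : Basis (Fin 7) ℝ V) : hodgeDual (g2Form e) = fourForm 1 e.dualBasis := by
  rw [g2Form_eq_threeForm, hodgeDual, inducedMetric_threeForm (Or.inl rfl),
    hodgeStar_threeForm (Or.inl rfl), e.coe_dualBasis]

theorem hodgeDual_g2StarForm {V : Type*} [AddCommGroup V] [Module ℝ V] [FiniteDimensional ℝ V]
    (e : Basis (Fin 7) ℝ V) : hodgeDual (g2StarForm e) = fourForm (-1) e.dualBasis := by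
  rw [g2StarForm_eq_threeForm, hodgeDual, inducedMetric_threeForm (Or.inr rfl),
    hodgeStar_threeForm (Or.inr rfl), e.coe_dualBasis]

theorem hodgeDualC_g2Form {W : Type*} [AddCommGroup W] [Module ℂ W] [FiniteDimensional ℂ W]
    (e : Basis (Fin 7) ℂ W) : hodgeDualC (g2Form e) (e7 e) = fourForm 1 e.dualBasis := by
  rw [g2Form_eq_threeForm, hodgeDualC, inducedMetricC_threeForm, hodgeStar_threeForm (Or.inl rfl),
    e.coe_dualBasis]

end InducedMetric

end G2Inv

theorem mainTheorem11
    {V : Type*} [AddCommGroup V] [Module ℝ V] [FiniteDimensional ℝ V]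
    (hV : Module.finrank ℝ V = 7)
    {W : Type*} [AddCommGroup W] [Module ℂ W] [FiniteDimensional ℂ W]
    (hW : Module.finrank ℂ W = 7) :
    (∀ φ : G2Inv.Form ℝ V 3, G2Inv.IsG2Structure φ →
      (G2Inv.rank (G2Inv.hodgeDual φ), G2Inv.length (G2Inv.hodgeDual φ),
        G2Inv.invM (G2Inv.hodgeDual φ), G2Inv.invR (G2Inv.hodgeDual φ)) = (7, 5, 3, 3)) ∧
    (∀ φ : G2Inv.Form ℝ V 3, G2Inv.IsG2StarStructure φ →
      (G2Inv.rank (G2Inv.hodgeDual φ), G2Inv.length (G2Inv.hodgeDual φ),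
        G2Inv.invM (G2Inv.hodgeDual φ), G2Inv.invR (G2Inv.hodgeDual φ)) = (7, 4, 2, 2)) ∧
    (∀ (φ : G2Inv.Form ℂ W 3) (vol : G2Inv.Form ℂ W 7), G2Inv.IsG2CStructure φ vol →
      (G2Inv.rank (G2Inv.hodgeDualC φ vol), G2Inv.length (G2Inv.hodgeDualC φ vol),
        G2Inv.invM (G2Inv.hodgeDualC φ vol), G2Inv.invR (G2Inv.hodgeDualC φ vol)) =
          (7, 4, 2, 2)) := by
  refine ⟨?_, ?_, ?_⟩
  · rintro _ ⟨e, rfl⟩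
    rw [G2Inv.hodgeDual_g2Form]
    exact G2Inv.invariants_fourForm_one e.dualBasis
  · rintro _ ⟨e, rfl⟩
    rw [G2Inv.hodgeDual_g2StarForm]
    exact G2Inv.invariants_fourForm_of_sq_eq (t := 1) (Or.inr rfl) (by norm_num) e.dualBasis
  · rintro _ _ ⟨e, rfl, rfl⟩
    rw [G2Inv.hodgeDualC_g2Form]
    exact G2Inv.invariants_fourForm_of_sq_eq (t := Complex.I) (Or.inl rfl) Complex.I_sq e.dualBasis
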